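/- Let $(M,g)$ be a $d$-dimensional Riemannian manifold without boundary (smooth, Hausdorff, second countable), let $\mu$ be a probability measure on $M$ with a smooth density $\rho\ge 0$ with respect to the Riemannian volume, $d\mu=\rho\,d\mathrm{vol}_g$, and let $X_1,\dots,X_k$ be smooth vector fields on $M$, with the associated sub-Laplacian $L=-\sum_{m=1}^k X_m^*X_m$ on $L^2(M,\mu)$ and horizontal gradient $\nabla=(X_1,\dots,X_k)$. For complex-valued $u,v$ put $$\Gamma(u,v)=\sum_{m=1}^k\overline{X_mu}\;X_mv .$$ Let $P:L^\infty(M,\mu)\to L^\infty(M,\mu)$ be a $\mu$-preserving Markov map: $P$ is linear, $P1=1$, $Pf\ge0$ whenever $f\ge0$, and $\int Pf\,d\mu=\int f\,d\mu$. Let $P^\dagger$ be the adjoint on $L^2(M,\mu)$ of the extension of $P$ to $L^2(M,\mu)$. Assume that $Pf$ has a continuously differentiable representative for every $f\in C_c^\infty(M)$ (so that $\nabla Pf$ and $\Gamma(Pf,Ph)$ make sense), and that for some constant $C\in\mathbb R$ and all complex-valued $f\in C_c^\infty(M)$ $$\Gamma(Pf,Pf)\le C\,P\,\Gamma(f,f)\qquad\mu\text{-a.e.}$$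 $P$, $P^\dagger$ and $X_m$ act on matrix-valued functions entrywise, powers of positive semidefinite matrices are taken pointwise by functional calculus with $A^0=\mathbf 1$, matrix inequalities are in the Loewner order, and $\mathbb M_n$ denotes the complex $n\times n$ matrices. Then: (i) For all $n$ and all $f_1,\dots,f_n\in C_c^\infty(M)$, $$\big[\Gamma(Pf_i,Pf_j)\big]_{i,j=1}^n\le C\,\big[P\,\Gamma(f_i,f_j)\big]_{i,j=1}^n\qquad\mu\text{-a.e.}$$ (ii) For all $n$, all $0\le s\le1$ and all $f,A,B\in C_c^\infty(M,\mathbb M_n)$ with $A,B\ge0$ pointwise, $$\sum_{m=1}^k\int_M\mathrm{tr}\big((X_mPf)^*A^s(X_mPf)B^{1-s}\big)\,d\mu\;\le\; C\sum_{m=1}^k\int_M\mathrm{tr}\big((X_mf)^*(P^\dagger A)^s(X_mf)(P^\dagger B)^{1-s}\big)\,d\mu ,$$ that is, $\langle\nabla Pf,A^s(\nabla Pf)B^{1-s}\rangle_{\mathrm{tr}}\le C\langle\nabla f,(P^\dagger A)^s(\nabla f)(P^\dagger B)^{1-s}\rangle_{\mathrm{tr}}$, where both integrands (summed over $m$) are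 $\mu$-integrable. In particular, for every $f=(f_{ij})\in C_c^\infty(M,\mathbb M_n)$, $$\Gamma(Pf,Pf)\le C\,P\,\Gamma(f,f)\qquad\mu\text{-a.e.},\qquad\text{where }\ \Gamma(f,f)=\Big[\sum_{l=1}^n\Gamma(f_{li},f_{lj})\Big]_{i,j=1}^n .$$ -/

import Mathlib

open MeasureTheory
open scoped ENNReal ComplexOrder MatrixOrder Manifold ContDiff

noncomputable section

/-! ## Smooth functions, vector fields, smooth measures -/

/-- `f ∈ C_c^∞(M)`, complex-valued. -/
structure IsTestFunction {d : ℕ} {M : Type*} [TopologicalSpace M]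
    [ChartedSpace (EuclideanSpace ℝ (Fin d)) M] (f : M → ℂ) : Prop where
  smooth : ContMDiff 𝓘(ℝ, EuclideanSpace ℝ (Fin d)) 𝓘(ℝ, ℂ) ∞ f
  compactSupport : HasCompactSupport f

/-- `f ∈ C_c^∞(M, 𝕄_n)`, where `𝕄_n` is the algebra of complex `n × n` matrices. -/
def IsMatrixTestFunction {d : ℕ} {M : Type*} [TopologicalSpace M]
    [ChartedSpace (EuclideanSpace ℝ (Fin d)) M] {n : ℕ}
    (f : M → Matrix (Fin n) (Fin n) ℂ) : Prop :=
  ∀ i j, IsTestFunction (d := d) (fun x => f x i j)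

/-- `X` is a smooth (real) vector field on `M`. -/
def IsSmoothVectorField {d : ℕ} {M : Type*} [TopologicalSpace M]
    [ChartedSpace (EuclideanSpace ℝ (Fin d)) M]
    [IsManifold 𝓘(ℝ, EuclideanSpace ℝ (Fin d)) ∞ M]
    (X : ∀ x : M, TangentSpace 𝓘(ℝ, EuclideanSpace ℝ (Fin d)) x) : Prop :=
  ContMDiff 𝓘(ℝ, EuclideanSpace ℝ (Fin d))
    𝓘(ℝ, EuclideanSpace ℝ (Fin d)).tangent ∞
    (fun x => (⟨x, X x⟩ : TangentBundle 𝓘(ℝ, EuclideanSpace ℝ (Fin d)) M))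

/-- The Gram matrix `g(∂_i, ∂_j)` of the coordinate vector fields of the chart `e`,
at the point with coordinates `y`. -/
def chartGram {d : ℕ} {M : Type*} [TopologicalSpace M]
    [ChartedSpace (EuclideanSpace ℝ (Fin d)) M]
    [IsManifold 𝓘(ℝ, EuclideanSpace ℝ (Fin d)) ∞ M]
    (g : Bundle.ContMDiffRiemannianMetric 𝓘(ℝ, EuclideanSpace ℝ (Fin d)) ∞
      (EuclideanSpace ℝ (Fin d))
      (fun x : M => TangentSpace 𝓘(ℝ, EuclideanSpace ℝ (Fin d)) x))
    (e : OpenPartialHomeomorph M (EuclideanSpace ℝ (Fin d)))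
    (y : EuclideanSpace ℝ (Fin d)) : Matrix (Fin d) (Fin d) ℝ :=
  Matrix.of fun i j =>
    g.inner (e.symm y)
      (mfderiv 𝓘(ℝ, EuclideanSpace ℝ (Fin d)) 𝓘(ℝ, EuclideanSpace ℝ (Fin d)) e.symm y
        (EuclideanSpace.single i (1 : ℝ)))
      (mfderiv 𝓘(ℝ, EuclideanSpace ℝ (Fin d)) 𝓘(ℝ, EuclideanSpace ℝ (Fin d)) e.symm y
        (EuclideanSpace.single j (1 : ℝ)))

/-- `dμ = ρ dvol_g` for some smooth density `ρ ≥ 0`: in each chart, `μ` has the density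
`ρ √det(g_ij)` with respect to Lebesgue measure. -/
def HasSmoothDensity {d : ℕ} {M : Type*} [TopologicalSpace M]
    [ChartedSpace (EuclideanSpace ℝ (Fin d)) M]
    [IsManifold 𝓘(ℝ, EuclideanSpace ℝ (Fin d)) ∞ M] [MeasurableSpace M]
    (g : Bundle.ContMDiffRiemannianMetric 𝓘(ℝ, EuclideanSpace ℝ (Fin d)) ∞
      (EuclideanSpace ℝ (Fin d))
      (fun x : M => TangentSpace 𝓘(ℝ, EuclideanSpace ℝ (Fin d)) x))
    (μ : Measure M) : Prop :=
  ∃ ρ : M → ℝ, ContMDiff 𝓘(ℝ, EuclideanSpace ℝ (Fin d)) 𝓘(ℝ, ℝ) ∞ ρ ∧ (∀ x, 0 ≤ ρ x) ∧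
    ∀ x₀ : M, ∀ s : Set M, MeasurableSet s →
      s ⊆ (chartAt (EuclideanSpace ℝ (Fin d)) x₀).source →
      μ s = ∫⁻ y in (chartAt (EuclideanSpace ℝ (Fin d)) x₀) '' s,
        ENNReal.ofReal (ρ ((chartAt (EuclideanSpace ℝ (Fin d)) x₀).symm y) *
          Real.sqrt (chartGram g (chartAt (EuclideanSpace ℝ (Fin d)) x₀) y).det)

/-- The derivative `X u` of a complex-valued function `u` along a vector field `X`. -/
def lieDeriv {d : ℕ} {M : Type*} [TopologicalSpace M]
    [ChartedSpace (EuclideanSpace ℝ (Fin d)) M]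
    (X : ∀ x : M, TangentSpace 𝓘(ℝ, EuclideanSpace ℝ (Fin d)) x) (u : M → ℂ) (x : M) : ℂ :=
  mfderiv 𝓘(ℝ, EuclideanSpace ℝ (Fin d)) 𝓘(ℝ, ℂ) u x (X x)

/-- The horizontal gradient form `Γ(u, v) = ∑ₘ conj(Xₘ u) Xₘ v`. -/
def gradForm {d : ℕ} {M : Type*} [TopologicalSpace M]
    [ChartedSpace (EuclideanSpace ℝ (Fin d)) M] {k : ℕ}
    (X : Fin k → ∀ x : M, TangentSpace 𝓘(ℝ, EuclideanSpace ℝ (Fin d)) x)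
    (u v : M → ℂ) (x : M) : ℂ :=
  ∑ m, star (lieDeriv (X m) u x) * lieDeriv (X m) v x

/-- The matrix-valued function `Xₘ f`, for the `m`-th vector field and matrix-valued `f`. -/
def matLieDeriv {d : ℕ} {M : Type*} [TopologicalSpace M]
    [ChartedSpace (EuclideanSpace ℝ (Fin d)) M] {n : ℕ}
    (X : ∀ x : M, TangentSpace 𝓘(ℝ, EuclideanSpace ℝ (Fin d)) x)
    (f : M → Matrix (Fin n) (Fin n) ℂ) (x : M) : Matrix (Fin n) (Fin n) ℂ :=
  Matrix.of fun i j => lieDeriv X (fun y => f y i j) x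

/-- The matrix-valued gradient form `Γ(f, g)_{ij} = ∑ₗ Γ(f_{li}, g_{lj})`. -/
def matGradForm {d : ℕ} {M : Type*} [TopologicalSpace M]
    [ChartedSpace (EuclideanSpace ℝ (Fin d)) M] {k n : ℕ}
    (X : Fin k → ∀ x : M, TangentSpace 𝓘(ℝ, EuclideanSpace ℝ (Fin d)) x)
    (f g : M → Matrix (Fin n) (Fin n) ℂ) (x : M) : Matrix (Fin n) (Fin n) ℂ :=
  Matrix.of fun i j => ∑ l, gradForm X (fun y => f y l i) (fun y => g y l j) x

/-! ## Markov maps and their adjoints -/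

/-- `P` is a Markov map on `L^∞(μ)` (unital and positivity preserving) that preserves `μ`. -/
structure IsMarkovPreserving {Ω : Type*} [MeasurableSpace Ω] (μ : Measure Ω)
    [IsProbabilityMeasure μ] (P : Lp ℂ ∞ μ →ₗ[ℂ] Lp ℂ ∞ μ) : Prop where
  map_one : P (Lp.const ∞ μ (1 : ℂ)) = Lp.const ∞ μ (1 : ℂ)
  map_nonneg : ∀ f : Lp ℂ ∞ μ, (∀ᵐ x ∂μ, 0 ≤ f x) → ∀ᵐ x ∂μ, 0 ≤ P f x
  integral_map : ∀ f : Lp ℂ ∞ μ, ∫ x, P f x ∂μ = ∫ x, f x ∂μ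

open scoped Classical in
/-- The class in `L^p(μ)` of a function in `ℒ^p(μ)`. -/
def toLpClass {Ω : Type*} [MeasurableSpace Ω] (p : ℝ≥0∞) (μ : Measure Ω) (f : Ω → ℂ) : Lp ℂ p μ :=
  if h : MemLp f p μ then h.toLp f else 0

/-- The inclusion `L^∞(μ) → L²(μ)`. -/
def inclTwo {Ω : Type*} [MeasurableSpace Ω] (μ : Measure Ω) [IsProbabilityMeasure μ] :
    Lp ℂ ∞ μ →ₗ[ℂ] Lp ℂ 2 μ where
  toFun f := ((Lp.memLp f).mono_exponent le_top).toLp f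
  map_add' f g := by
    ext1
    filter_upwards [MemLp.coeFn_toLp ((Lp.memLp (f + g)).mono_exponent (p := 2) le_top),
      MemLp.coeFn_toLp ((Lp.memLp f).mono_exponent (p := 2) le_top),
      MemLp.coeFn_toLp ((Lp.memLp g).mono_exponent (p := 2) le_top),
      Lp.coeFn_add f g, Lp.coeFn_add (((Lp.memLp f).mono_exponent (p := 2) le_top).toLp f)
        (((Lp.memLp g).mono_exponent (p := 2) le_top).toLp g)] with x h1 h2 h3 h4 h5
    rw [h1, h5, Pi.add_apply, h2, h3, h4, Pi.add_apply]
  map_smul' c f := by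
    ext1
    filter_upwards [MemLp.coeFn_toLp ((Lp.memLp (c • f)).mono_exponent (p := 2) le_top),
      MemLp.coeFn_toLp ((Lp.memLp f).mono_exponent (p := 2) le_top),
      Lp.coeFn_smul c f,
      Lp.coeFn_smul c (((Lp.memLp f).mono_exponent (p := 2) le_top).toLp f)] with x h1 h2 h3 h4
    rw [h1, RingHom.id_apply, h4, Pi.smul_apply, h2, h3, Pi.smul_apply]

/-- The bounded extension of `P` to `L²(μ)`. -/
def extendTwo {Ω : Type*} [MeasurableSpace Ω] (μ : Measure Ω) [IsProbabilityMeasure μ]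
    (P : Lp ℂ ∞ μ →ₗ[ℂ] Lp ℂ ∞ μ) : Lp ℂ 2 μ →L[ℂ] Lp ℂ 2 μ :=
  (inclTwo μ ∘ₗ P).extendOfNorm (inclTwo μ)

/-- The adjoint `P†` on `L²(μ)` of (the extension to `L²(μ)` of) `P`. -/
def dagger {Ω : Type*} [MeasurableSpace Ω] (μ : Measure Ω) [IsProbabilityMeasure μ]
    (P : Lp ℂ ∞ μ →ₗ[ℂ] Lp ℂ ∞ μ) : Lp ℂ 2 μ →L[ℂ] Lp ℂ 2 μ :=
  ContinuousLinearMap.adjoint (extendTwo μ P)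

/-! ## Entrywise application to functions -/

/-- The element `h` of `L^∞(μ)` has a continuously differentiable representative. -/
def HasC1Version {d : ℕ} {M : Type*} [TopologicalSpace M]
    [ChartedSpace (EuclideanSpace ℝ (Fin d)) M] [MeasurableSpace M]
    (μ : Measure M) (h : Lp ℂ ∞ μ) : Prop :=
  ∃ u : M → ℂ, ContMDiff 𝓘(ℝ, EuclideanSpace ℝ (Fin d)) 𝓘(ℝ, ℂ) 1 u ∧ u =ᵐ[μ] h

open scoped Classical in
/-- A continuously differentiable representative of `h ∈ L^∞(μ)` (any representative, if there is
no such one); for a measure with a smooth density, its derivatives are determined `μ`-almost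
everywhere. -/
def c1Version {d : ℕ} {M : Type*} [TopologicalSpace M]
    [ChartedSpace (EuclideanSpace ℝ (Fin d)) M] [MeasurableSpace M]
    (μ : Measure M) (h : Lp ℂ ∞ μ) : M → ℂ :=
  if hh : HasC1Version (d := d) μ h then hh.choose else h

/-- `P f` for a test function `f`, as a continuously differentiable function. -/
def applyP {d : ℕ} {M : Type*} [TopologicalSpace M]
    [ChartedSpace (EuclideanSpace ℝ (Fin d)) M] [MeasurableSpace M]
    (μ : Measure M) (P : Lp ℂ ∞ μ →ₗ[ℂ] Lp ℂ ∞ μ) (f : M → ℂ) : M → ℂ :=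
  c1Version (d := d) μ (P (toLpClass ∞ μ f))

/-- `P f` for a matrix-valued test function `f`: `P` acts entrywise. -/
def matApplyP {d : ℕ} {M : Type*} [TopologicalSpace M]
    [ChartedSpace (EuclideanSpace ℝ (Fin d)) M] [MeasurableSpace M] {n : ℕ}
    (μ : Measure M) (P : Lp ℂ ∞ μ →ₗ[ℂ] Lp ℂ ∞ μ)
    (f : M → Matrix (Fin n) (Fin n) ℂ) (x : M) : Matrix (Fin n) (Fin n) ℂ :=
  Matrix.of fun i j => applyP (d := d) μ P (fun y => f y i j) x

/-- `P F` for a bounded matrix-valued function `F`, entrywise, as a function defined up to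
`μ`-null sets. -/
def matApplyLinf {Ω : Type*} [MeasurableSpace Ω] {n : ℕ}
    (μ : Measure Ω) (P : Lp ℂ ∞ μ →ₗ[ℂ] Lp ℂ ∞ μ)
    (F : Ω → Matrix (Fin n) (Fin n) ℂ) (x : Ω) : Matrix (Fin n) (Fin n) ℂ :=
  Matrix.of fun i j => P (toLpClass ∞ μ (fun y => F y i j)) x

/-- `P† F` for a matrix-valued function `F` with square-integrable entries, entrywise, as a
function defined up to `μ`-null sets. -/
def matDagger {Ω : Type*} [MeasurableSpace Ω] {n : ℕ}
    (μ : Measure Ω) [IsProbabilityMeasure μ] (P : Lp ℂ ∞ μ →ₗ[ℂ] Lp ℂ ∞ μ)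
    (F : Ω → Matrix (Fin n) (Fin n) ℂ) (x : Ω) : Matrix (Fin n) (Fin n) ℂ :=
  Matrix.of fun i j => dagger μ P (toLpClass 2 μ (fun y => F y i j)) x

/-- The power `A^s` of a positive semidefinite matrix, by functional calculus (`A^0 = 1`). -/
def matPow {n : ℕ} (A : Matrix (Fin n) (Fin n) ℂ) (s : ℝ) : Matrix (Fin n) (Fin n) ℂ :=
  cfc (fun t : ℝ => t ^ s) A

/-- The density `∑ₘ tr((Xₘ f)^* Q (Xₘ f) R)` of the pairing `⟨∇f, Q (∇f) R⟩_tr`. -/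
def gradPairing {d : ℕ} {M : Type*} [TopologicalSpace M]
    [ChartedSpace (EuclideanSpace ℝ (Fin d)) M] {k n : ℕ}
    (X : Fin k → ∀ x : M, TangentSpace 𝓘(ℝ, EuclideanSpace ℝ (Fin d)) x)
    (f Q R : M → Matrix (Fin n) (Fin n) ℂ) (x : M) : ℂ :=
  ∑ m, ((matLieDeriv (X m) f x).conjTranspose * (Q x * matLieDeriv (X m) f x * R x)).trace

/-! ## The definitions above do not fall into their default branches -/

theorem inclTwo_coeFn {Ω : Type*} [MeasurableSpace Ω] (μ : Measure Ω) [IsProbabilityMeasure μ]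
    (f : Lp ℂ ∞ μ) : inclTwo μ f =ᵐ[μ] f :=
  MemLp.coeFn_toLp ((Lp.memLp f).mono_exponent (p := 2) le_top)

theorem inclTwo_denseRange {Ω : Type*} [MeasurableSpace Ω] (μ : Measure Ω)
    [IsProbabilityMeasure μ] : DenseRange (inclTwo μ) := by
  refine (Lp.simpleFunc.dense (E := ℂ) (μ := μ) (p := 2) (by simp)).mono ?_
  intro f hf
  obtain ⟨s, hs⟩ := hf
  have hm : MemLp s ∞ μ := s.memLp_top μ
  refine ⟨hm.toLp s, ?_⟩
  ext1
  filter_upwards [inclTwo_coeFn μ (hm.toLp s), hm.coeFn_toLp,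
    AEEqFun.coeFn_mk (μ := μ) s s.aestronglyMeasurable] with x h1 h2 h3
  rw [h1, h2, ← hs, h3]

/-- The pointwise inequality `|P f|² ≤ P |f|²`. -/
theorem IsMarkovPreserving.normSq_le {Ω : Type*} [MeasurableSpace Ω] {μ : Measure Ω}
    [IsProbabilityMeasure μ] {P : Lp ℂ ∞ μ →ₗ[ℂ] Lp ℂ ∞ μ} (hP : IsMarkovPreserving μ P)
    (f h : Lp ℂ ∞ μ) (hh : ∀ᵐ x ∂μ, h x = ((‖f x‖ ^ 2 : ℝ) : ℂ)) :
    ∀ᵐ x ∂μ, ‖P f x‖ ^ 2 ≤ (P h x).re := by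
  set f' : Lp ℂ ∞ μ := star f
  have key : ∀ c : ℂ, ∀ᵐ x ∂μ,
      0 ≤ P h x - star c * P f x - c * P f' x + ((‖c‖ ^ 2 : ℝ) : ℂ) := by
    intro c
    set F : Lp ℂ ∞ μ := h - star c • f - c • f' + ((‖c‖ ^ 2 : ℝ) : ℂ) • Lp.const ∞ μ (1 : ℂ)
    have hF : ∀ᵐ x ∂μ, 0 ≤ F x := by
      filter_upwards [hh, Lp.coeFn_add (h - star c • f - c • f')
          (((‖c‖ ^ 2 : ℝ) : ℂ) • Lp.const ∞ μ (1 : ℂ)),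
        Lp.coeFn_sub (h - star c • f) (c • f'), Lp.coeFn_sub h (star c • f),
        Lp.coeFn_smul (star c) f, Lp.coeFn_smul c f', Lp.coeFn_star f,
        Lp.coeFn_smul ((‖c‖ ^ 2 : ℝ) : ℂ) (Lp.const ∞ μ (1 : ℂ)),
        Lp.coeFn_const (p := ∞) (μ := μ) (1 : ℂ)] with x h0 h1 h2 h3 h4 h5 h6 h7 h8
      have : F x = ((‖f x - c‖ ^ 2 : ℝ) : ℂ) := by
        rw [h1, Pi.add_apply, h2, Pi.sub_apply, h3, Pi.sub_apply, h4, h5, h7, Pi.smul_apply,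
          Pi.smul_apply, Pi.smul_apply, h6, h8, h0]
        simp only [Pi.star_apply, Function.const_apply, smul_eq_mul, ← Complex.normSq_eq_norm_sq,
          ← Complex.mul_conj, Complex.star_def, map_sub]
        ring
      rw [this]
      exact Complex.zero_le_real.2 (sq_nonneg _)
    have hPF : P F = P h - star c • P f - c • P f' +
        ((‖c‖ ^ 2 : ℝ) : ℂ) • Lp.const ∞ μ (1 : ℂ) := by
      simp only [F, map_add, map_sub, map_smul, hP.map_one]
    have := hP.map_nonneg F hF
    rw [hPF] at this
    filter_upwards [this, Lp.coeFn_add (P h - star c • P f - c • P f')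
          (((‖c‖ ^ 2 : ℝ) : ℂ) • Lp.const ∞ μ (1 : ℂ)),
        Lp.coeFn_sub (P h - star c • P f) (c • P f'), Lp.coeFn_sub (P h) (star c • P f),
        Lp.coeFn_smul (star c) (P f), Lp.coeFn_smul c (P f'),
        Lp.coeFn_smul ((‖c‖ ^ 2 : ℝ) : ℂ) (Lp.const ∞ μ (1 : ℂ)),
        Lp.coeFn_const (p := ∞) (μ := μ) (1 : ℂ)] with x h0 h1 h2 h3 h4 h5 h7 h8
    rw [h1, Pi.add_apply, h2, Pi.sub_apply, h3, Pi.sub_apply, h4, h5, h7, Pi.smul_apply,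
      Pi.smul_apply, Pi.smul_apply, h8] at h0
    simpa using h0
  have hall : ∀ᵐ x ∂μ, ∀ i : ℕ,
      0 ≤ P h x - star (TopologicalSpace.denseSeq ℂ i) * P f x
        - TopologicalSpace.denseSeq ℂ i * P f' x
        + ((‖TopologicalSpace.denseSeq ℂ i‖ ^ 2 : ℝ) : ℂ) := ae_all_iff.2 fun i => key _
  filter_upwards [hall, key 0, key 1, key Complex.I] with x hx h0 h1 hI
  have hc : ∀ c : ℂ, 0 ≤ P h x - star c * P f x - c * P f' x + ((‖c‖ ^ 2 : ℝ) : ℂ) := by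
    intro c
    refine (TopologicalSpace.denseRange_denseSeq ℂ).induction_on
      (p := fun c : ℂ => 0 ≤ P h x - star c * P f x - c * P f' x + ((‖c‖ ^ 2 : ℝ) : ℂ)) c ?_ hx
    exact isClosed_le continuous_const (by fun_prop)
  have hu := hc (P f x)
  have e0 := (Complex.le_def.1 h0).2
  have e1 := (Complex.le_def.1 h1).2
  have eI := (Complex.le_def.1 hI).2
  simp at e0 e1 eI
  have hconj : P f' x = star (P f x) := by
    apply Complex.ext <;> simp <;> linarith
  rw [hconj, ← Complex.normSq_eq_norm_sq, ← Complex.mul_conj] at hu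
  have := (Complex.le_def.1 hu).1
  simp only [Complex.star_def, Complex.mul_conj, Complex.add_re, Complex.sub_re,
    Complex.ofReal_re, Complex.zero_re, mul_comm ((starRingEnd ℂ) (P f x))] at this
  rw [← Complex.normSq_eq_norm_sq]
  linarith

theorem IsMarkovPreserving.norm_inclTwo_le {Ω : Type*} [MeasurableSpace Ω] {μ : Measure Ω}
    [IsProbabilityMeasure μ] {P : Lp ℂ ∞ μ →ₗ[ℂ] Lp ℂ ∞ μ} (hP : IsMarkovPreserving μ P)
    (f : Lp ℂ ∞ μ) : ‖inclTwo μ (P f)‖ ≤ ‖inclTwo μ f‖ := by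
  have hsq : ∀ u : Lp ℂ ∞ μ, ‖inclTwo μ u‖ ^ 2 = ∫ x, ‖u x‖ ^ 2 ∂μ := by
    intro u
    have h1 := inner_self_eq_norm_sq (𝕜 := ℂ) (inclTwo μ u)
    rw [← h1, L2.inner_def, ← integral_re (L2.integrable_inner _ _)]
    refine integral_congr_ae ?_
    filter_upwards [inclTwo_coeFn μ u] with x hx
    rw [hx]
    exact inner_self_eq_norm_sq (𝕜 := ℂ) (u x)
  have hm : MemLp (fun x => ((‖f x‖ ^ 2 : ℝ) : ℂ)) ∞ μ := by
    have h2 : MemLp (star f : Lp ℂ ∞ μ) ∞ μ := Lp.memLp _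
    have h3 : MemLp (fun x => (star f : Lp ℂ ∞ μ) x * f x) ∞ μ :=
      MemLp.mul (p := ∞) (q := ∞) (r := ∞) (Lp.memLp f) h2
    refine h3.ae_eq ?_
    filter_upwards [Lp.coeFn_star f] with x hx
    rw [hx, ← Complex.normSq_eq_norm_sq, Complex.normSq_eq_conj_mul_self]
    rfl
  have hle := hP.normSq_le f (hm.toLp _) hm.coeFn_toLp
  have hint : ∀ u : Lp ℂ ∞ μ, Integrable u μ := fun u =>
    ((Lp.memLp u).mono_exponent (p := 1) le_top).integrable le_rfl
  refine le_of_sq_le_sq ?_ (norm_nonneg _)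
  rw [hsq, hsq]
  calc ∫ x, ‖P f x‖ ^ 2 ∂μ ≤ ∫ x, (P (hm.toLp _) x).re ∂μ := by
        refine integral_mono_of_nonneg (Filter.Eventually.of_forall fun x => sq_nonneg _)
          (hint _).re hle
    _ = (∫ x, P (hm.toLp _) x ∂μ).re := integral_re (hint _)
    _ = (∫ x, hm.toLp _ x ∂μ).re := by rw [hP.integral_map]
    _ = ∫ x, (hm.toLp _ x).re ∂μ := (integral_re (hint _)).symm
    _ = ∫ x, ‖f x‖ ^ 2 ∂μ := by
        refine integral_congr_ae ?_
        filter_upwards [hm.coeFn_toLp] with x hx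
        rw [hx, Complex.ofReal_re]

theorem IsMarkovPreserving.extendTwo_inclTwo {Ω : Type*} [MeasurableSpace Ω] {μ : Measure Ω}
    [IsProbabilityMeasure μ] {P : Lp ℂ ∞ μ →ₗ[ℂ] Lp ℂ ∞ μ} (hP : IsMarkovPreserving μ P)
    (f : Lp ℂ ∞ μ) : extendTwo μ P (inclTwo μ f) = inclTwo μ (P f) :=
  LinearMap.extendOfNorm_eq (inclTwo_denseRange μ)
    ⟨1, fun u => by simpa using hP.norm_inclTwo_le u⟩ f

theorem IsMarkovPreserving.inner_dagger {Ω : Type*} [MeasurableSpace Ω] {μ : Measure Ω}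
    [IsProbabilityMeasure μ] {P : Lp ℂ ∞ μ →ₗ[ℂ] Lp ℂ ∞ μ} (hP : IsMarkovPreserving μ P)
    (h : Lp ℂ 2 μ) (f : Lp ℂ ∞ μ) :
    inner ℂ (dagger μ P h) (inclTwo μ f) = inner ℂ h (inclTwo μ (P f)) := by
  rw [dagger, ContinuousLinearMap.adjoint_inner_left, hP.extendTwo_inclTwo]

theorem IsTestFunction.memLp {d : ℕ} {M : Type*} [TopologicalSpace M]
    [ChartedSpace (EuclideanSpace ℝ (Fin d)) M] [MeasurableSpace M] [OpensMeasurableSpace M]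
    {f : M → ℂ} (hf : IsTestFunction (d := d) f) (μ : Measure M) [IsProbabilityMeasure μ]
    (p : ℝ≥0∞) : MemLp f p μ :=
  (hf.smooth.continuous.memLp_top_of_hasCompactSupport hf.compactSupport μ).mono_exponent le_top

theorem IsTestFunction.gradForm_memLp {d : ℕ} {M : Type*} [TopologicalSpace M] [T2Space M]
    [ChartedSpace (EuclideanSpace ℝ (Fin d)) M]
    [IsManifold 𝓘(ℝ, EuclideanSpace ℝ (Fin d)) ∞ M] [MeasurableSpace M] [OpensMeasurableSpace M]
    {k : ℕ} {X : Fin k → ∀ x : M, TangentSpace 𝓘(ℝ, EuclideanSpace ℝ (Fin d)) x}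
    (hX : ∀ m, IsSmoothVectorField (X m)) {f g : M → ℂ} (hf : IsTestFunction (d := d) f)
    (hg : IsTestFunction (d := d) g) (μ : Measure M) [IsProbabilityMeasure μ] :
    MemLp (gradForm X f g) ∞ μ := by
  have hc : ∀ (u : M → ℂ), IsTestFunction (d := d) u → ∀ m, Continuous (lieDeriv (X m) u) := by
    intro u hu m
    have h1 : ContMDiff 𝓘(ℝ, EuclideanSpace ℝ (Fin d)).tangent 𝓘(ℝ, ℂ).tangent ∞
        (tangentMap 𝓘(ℝ, EuclideanSpace ℝ (Fin d)) 𝓘(ℝ, ℂ) u) :=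
      hu.smooth.contMDiff_tangentMap (by simp)
    have h2 := (contMDiff_snd_tangentBundle_modelSpace (n := ∞) ℂ 𝓘(ℝ, ℂ)).continuous.comp
      (h1.comp (hX m)).continuous
    exact h2
  refine Continuous.memLp_top_of_hasCompactSupport ?_ ?_ μ
  · exact continuous_finsetSum _ fun m _ => ((hc f hf m).star).mul (hc g hg m)
  · refine HasCompactSupport.intro hf.compactSupport fun x hx => ?_
    have hz : mfderiv 𝓘(ℝ, EuclideanSpace ℝ (Fin d)) 𝓘(ℝ, ℂ) f x = 0 := by
      have he : f =ᶠ[nhds x] fun _ => (0 : ℂ) := notMem_tsupport_iff_eventuallyEq.1 hx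
      rw [he.mfderiv_eq]
      exact mfderiv_const
    refine Finset.sum_eq_zero fun m _ => ?_
    have : lieDeriv (X m) f x = 0 := by
      unfold lieDeriv
      rw [hz]
      rfl
    rw [this]
    simp

end

/-! ## Positive semidefinite matrices -/

namespace Matrix

variable {ι : Type*} [Fintype ι]

/-! For (i), apply the scalar estimate to `∑ c i * f i`: both sides become quadratic forms in `c`,
so the matrix inequality holds against each fixed vector almost everywhere. A countable dense set of
vectors gives one common null set (`gradMatrix_applyP_le`). One point needs care: the continuously
differentiable representatives of `P f` are chosen separately for each `f`, so linearity holds only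
up to null sets. The smooth density repairs this, since continuous functions equal almost everywhere
agree near almost every point (`HasSmoothDensity.ae_eventuallyEq`), and so do their derivatives.

For (ii), write `K s` for the kernel `A^s ⊗ (B^(1-s))ᵀ`. The trace pairing is the entrywise pairing
of `K s` with the Gram matrix `[Γ(f_p, f_q)]`, `p` and `q` running over matrix positions
(`gradPairing_eq_sum`). Entrywise pairings of positive semidefinite matrices are nonnegative, so (i)
bounds the left side by `C` times the pairing of `K s` with `P Γ`. Duality moves `P` onto the kernel
as `P†`. It remains to prove Jensen's inequality `P† (A^s ⊗ (B^(1-s))ᵀ) ≤ (P† A)^s ⊗ ((P†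
B)^(1-s))ᵀ`.

`P†` is positive and unital, hence completely positive, on a commutative algebra. At `s = 0, 1`
Jensen is an equality. If it holds at `s` and `t`, apply `P†` to the positive block matrix with
diagonal `K s`, `K t` and off-diagonal `K ((s+t)/2)`, and enlarge the diagonal by the two known
bounds. The new diagonal blocks are squares `V²`, `W²` of commuting matrices, and
`PosSemidef.le_mul_of_fromBlocks` bounds the off-diagonal block by `V W`, which is Jensen at the
midpoint. This reaches all dyadic exponents; the remaining ones follow by dominated convergence in
the integrated inequality. -/

/-- Nonnegativity in the order of `ℂ` includes being real, and over `ℂ` a real quadratic form forces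
the matrix to be Hermitian. -/
theorem PosSemidef.of_forall_dotProduct {M : Matrix ι ι ℂ}
    (h : ∀ c : ι → ℂ, 0 ≤ star c ⬝ᵥ M *ᵥ c) : M.PosSemidef := by
  classical
  refine PosSemidef.of_dotProduct_mulVec_nonneg ?_ h
  rw [← isSymmetric_toEuclideanLin_iff, LinearMap.isSymmetric_iff_inner_map_self_real]
  intro v
  have h0 := h v.ofLp
  have h1 : inner ℂ (toEuclideanLin M v) v = star (star v.ofLp ⬝ᵥ M *ᵥ v.ofLp) := by
    rw [EuclideanSpace.inner_eq_star_dotProduct, dotProduct_star, toLpLin_apply,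
      dotProduct_comm]
  rw [h1]
  have := (Complex.le_def.1 h0).2
  apply Complex.ext <;> simp at this ⊢
  linarith

/-- Countably many test vectors are enough, so almost everywhere statements, each with its own null
set, can be combined. -/
theorem PosSemidef.of_forall_denseSeq {M : Matrix ι ι ℂ}
    (h : ∀ i : ℕ, 0 ≤ star (TopologicalSpace.denseSeq (ι → ℂ) i) ⬝ᵥ
      M *ᵥ (TopologicalSpace.denseSeq (ι → ℂ) i)) : M.PosSemidef := by
  refine .of_forall_dotProduct fun c => ?_
  refine (TopologicalSpace.denseRange_denseSeq (ι → ℂ)).induction_on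
      (p := fun c : ι → ℂ => 0 ≤ star c ⬝ᵥ M *ᵥ c) c ?_ h
  exact isClosed_le continuous_const (by fun_prop)

theorem isClosed_posSemidef : IsClosed {M : Matrix ι ι ℂ | M.PosSemidef} := by
  have : {M : Matrix ι ι ℂ | M.PosSemidef} = ⋂ c : ι → ℂ, {M | 0 ≤ star c ⬝ᵥ M *ᵥ c} := by
    ext M
    simp only [Set.mem_ofPred_eq, Set.mem_iInter]
    exact ⟨fun h c => h.dotProduct_mulVec_nonneg c, .of_forall_dotProduct⟩
  rw [this]
  exact isClosed_iInter fun c => isClosed_le continuous_const (by fun_prop)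

theorem dotProduct_mulVec_eq_sum (M : Matrix ι ι ℂ) (c : ι → ℂ) :
    star c ⬝ᵥ M *ᵥ c = ∑ i, ∑ j, star (c i) * c j * M i j := by
  simp only [dotProduct, mulVec, Finset.mul_sum, Pi.star_apply]
  exact Finset.sum_congr rfl fun i _ => Finset.sum_congr rfl fun j _ => by ring

/-- The bilinear pairing of two positive semidefinite matrices is nonnegative. -/
theorem PosSemidef.sum_mul_nonneg {M N : Matrix ι ι ℂ} (hM : M.PosSemidef) (hN : N.PosSemidef) :
    0 ≤ ∑ i, ∑ j, M i j * N i j := by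
  have := (hM.hadamard hN).dotProduct_mulVec_nonneg 1
  rw [dotProduct_mulVec_eq_sum] at this
  simpa using this

theorem sum_mul_le_sum_mul {M N G : Matrix ι ι ℂ} (h : M ≤ N) (hG : G.PosSemidef) :
    ∑ i, ∑ j, M i j * G i j ≤ ∑ i, ∑ j, N i j * G i j := by
  have := (le_iff.1 h).sum_mul_nonneg hG
  rw [← sub_nonneg]
  simpa [sub_mul, Finset.sum_sub_distrib] using this

/-- This turns a bound on the trace into a bound on all entries; every essential boundedness claim
for matrix functions below rests on it. -/
theorem PosSemidef.norm_apply_le {M : Matrix ι ι ℂ} (hM : M.PosSemidef) (i j : ι) :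
    ‖M i j‖ ≤ M.trace.re := by
  classical
  have hd : ∀ i, 0 ≤ M i i := fun i => hM.diag_nonneg
  have hre : ∀ i, 0 ≤ (M i i).re := fun i => (Complex.le_def.1 (hd i)).1
  have him : ∀ i, (M i i).im = 0 := fun i => (Complex.le_def.1 (hd i)).2.symm
  have htr : M.trace.re = ∑ i, (M i i).re := by simp [trace]
  by_cases hij : i = j
  · subst hij
    have : M i i = ((M i i).re : ℂ) := Complex.ext rfl (by simp [him])
    rw [this, Complex.norm_real, Real.norm_of_nonneg (hre i), htr]
    exact Finset.single_le_sum (fun k _ => hre k) (Finset.mem_univ i)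
  have hsum : (M i i).re + (M j j).re ≤ M.trace.re := by
    rw [htr, ← Finset.sum_pair (f := fun k => (M k k).re) hij]
    exact Finset.sum_le_sum_of_subset_of_nonneg (Finset.subset_univ _) fun k _ _ => hre k
  -- The phase `z` makes the cross terms as negative as possible: the form at `e_i + z e_j` is then
  -- `M i i + M j j - 2‖M i j‖`.
  obtain ⟨z, hz, hzM⟩ : ∃ z : ℂ, ‖z‖ = 1 ∧ z * M i j = -‖M i j‖ := by
    by_cases h0 : M i j = 0
    · exact ⟨1, by simp, by simp [h0]⟩
    · refine ⟨-‖M i j‖ / M i j, ?_, by field_simp⟩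
      rw [norm_div, norm_neg, Complex.norm_real, norm_norm, div_self (norm_ne_zero_iff.2 h0)]
  have h2 := hM.dotProduct_mulVec_nonneg (Pi.single i 1 + Pi.single j z)
  have hji : M j i = star (M i j) := (hM.1.apply j i).symm
  have hzz : star z * z = 1 := by
    rw [Complex.star_def, ← Complex.normSq_eq_conj_mul_self, Complex.normSq_eq_norm_sq, hz]; simp
  have h3 : star (Pi.single i 1 + Pi.single j z) ⬝ᵥ M *ᵥ (Pi.single i 1 + Pi.single j z)
      = M i i + z * M i j + star (z * M i j) + star z * z * M j j := by
    rw [star_mul', ← hji]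
    simp only [star_add, add_dotProduct, mulVec_add, dotProduct_add, mulVec_single,
      single_dotProduct, ← Pi.single_star]
    simp
    ring
  rw [h3, hzz, hzM] at h2
  have := (Complex.le_def.1 h2).1
  simp at this
  have := norm_nonneg (M i j)
  linarith

/-- The difference of the two block matrices is block diagonal with positive semidefinite blocks. -/
theorem PosSemidef.fromBlocks_mono {M N X M' N' : Matrix ι ι ℂ}
    (h : (fromBlocks M X X N).PosSemidef) (hM : M ≤ M') (hN : N ≤ N') :
    (fromBlocks M' X X N').PosSemidef := by
  have hb : (fromBlocks (M' - M) 0 0 (N' - N)).PosSemidef := by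
    refine .of_forall_dotProduct fun c => ?_
    obtain ⟨c1, c2, rfl⟩ : ∃ c1 c2, c = Sum.elim c1 c2 :=
      ⟨c ∘ Sum.inl, c ∘ Sum.inr, by simp⟩
    have : star (Sum.elim c1 c2) = Sum.elim (star c1) (star c2) := by
      ext i; cases i <;> simp
    rw [this, fromBlocks_mulVec, sumElim_dotProduct_sumElim]
    simp only [zero_mulVec, add_zero, zero_add, Function.comp_def, Sum.elim_inl,
      Sum.elim_inr]
    exact add_nonneg ((le_iff.1 hM).dotProduct_mulVec_nonneg _)
      ((le_iff.1 hN).dotProduct_mulVec_nonneg _)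
  have := h.add hb
  rw [fromBlocks_add] at this
  simpa using this

/-- For commuting positive definite `V`, `W`: if `[[V², X], [X, W²]]` is positive semidefinite,
then `X ≤ V W`. -/
theorem PosDef.le_mul_of_fromBlocks [DecidableEq ι] {V W X : Matrix ι ι ℂ} (hV : V.PosDef)
    (hW : W.PosDef) (hVW : Commute V W) (hX : X.IsHermitian)
    (h : (fromBlocks (V * V) X X (W * W)).PosSemidef) : X ≤ V * W := by
  have hunit : IsUnit V.det := (isUnit_iff_isUnit_det V).1 hV.isUnit
  have hc' : V⁻¹ * W = W * V⁻¹ := by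
    calc V⁻¹ * W = V⁻¹ * (W * V) * V⁻¹ := by
          rw [mul_assoc, mul_assoc, mul_nonsing_inv V hunit, mul_one]
      _ = W * V⁻¹ := by rw [← hVW.eq, ← mul_assoc V⁻¹, nonsing_inv_mul V hunit, one_mul]
  have hpos : ∀ {A B : Matrix ι ι ℂ}, A.PosDef → B.PosDef → Commute A B → (A * B).PosDef := by
    intro A B hA hB hAB
    have h0 : 0 ≤ A * B := hAB.mul_nonneg (nonneg_iff_posSemidef.2 hA.posSemidef)
      (nonneg_iff_posSemidef.2 hB.posSemidef)
    exact (nonneg_iff_posSemidef.1 h0).posDef_iff_isUnit.2 (hA.isUnit.mul hB.isUnit)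
  have hD : (V⁻¹ * W).PosDef := hpos hV.inv hW hc'
  have hS : (V * W).PosDef := hpos hV hW hVW
  have hH : (V * W - X).IsHermitian := hS.1.sub hX
  rw [le_iff, hH.posSemidef_iff_eigenvalues_nonneg]
  intro j
  -- Suppose `V W - X` has an eigenvector `w` with eigenvalue `κ < 0`. With `u = V⁻¹ W w`, the block
  -- form at `(u, -w)` equals `2 κ ⟨w, V⁻¹ W w⟩`, which is negative because `V⁻¹ W` is positive
  -- definite.
  by_contra hneg
  simp only [Pi.zero_apply, not_le] at hneg
  set w : ι → ℂ := ⇑(hH.eigenvectorBasis j) with hw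
  set κ := hH.eigenvalues j
  have hw0 : w ≠ 0 := by
    intro h0
    have := hH.eigenvectorBasis.orthonormal.1 j
    have h1 : hH.eigenvectorBasis j = 0 := by ext i; exact congrFun h0 i
    simp [h1] at this
  have heig : (V * W - X) *ᵥ w = (κ : ℂ) • w := by
    have := hH.mulVec_eigenvectorBasis j
    rw [this]; ext i; simp [hw, κ]
  have hXw : X *ᵥ w = (V * W) *ᵥ w - (κ : ℂ) • w := by
    rw [← heig, sub_mulVec]; abel
  set u := (V⁻¹ * W) *ᵥ w with hu
  have hq := h.dotProduct_mulVec_nonneg (Sum.elim u (-w))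
  have hVu : V *ᵥ u = W *ᵥ w := by
    rw [hu, mulVec_mulVec, ← mul_assoc, mul_nonsing_inv V hunit, one_mul]
  have e1 : star u ⬝ᵥ (V * V) *ᵥ u = star (W *ᵥ w) ⬝ᵥ (W *ᵥ w) := by
    rw [← mulVec_mulVec, hVu, dotProduct_mulVec, ← hVu, star_mulVec V, hV.1.eq]
  have e2 : star u ⬝ᵥ X *ᵥ w = star (W *ᵥ w) ⬝ᵥ (W *ᵥ w) - κ * (star u ⬝ᵥ w) := by
    rw [hXw, dotProduct_sub, dotProduct_smul, smul_eq_mul, ← mulVec_mulVec, dotProduct_mulVec,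
      ← hVu, star_mulVec V, hV.1.eq]
  have e4 : star w ⬝ᵥ (W * W) *ᵥ w = star (W *ᵥ w) ⬝ᵥ (W *ᵥ w) := by
    rw [← mulVec_mulVec, dotProduct_mulVec, star_mulVec, hW.1.eq]
  have hstar : star u ⬝ᵥ w = star w ⬝ᵥ (V⁻¹ * W) *ᵥ w := by
    rw [hu, star_mulVec, hD.1.eq, dotProduct_mulVec]
  have e3 : star w ⬝ᵥ X *ᵥ u = star (star u ⬝ᵥ X *ᵥ w) := by
    rw [star_dotProduct, star_mulVec, hX.eq, dotProduct_mulVec]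
  have hδ : 0 < star u ⬝ᵥ w := by rw [hstar]; exact hD.dotProduct_mulVec_pos hw0
  have hexp : star (Sum.elim u (-w)) ⬝ᵥ fromBlocks (V * V) X X (W * W) *ᵥ (Sum.elim u (-w))
      = star u ⬝ᵥ (V * V) *ᵥ u - star u ⬝ᵥ X *ᵥ w - star w ⬝ᵥ X *ᵥ u
        + star w ⬝ᵥ (W * W) *ᵥ w := by
    rw [fromBlocks_mulVec]
    have : star (Sum.elim u (-w)) = Sum.elim (star u) (-star w) := by
      ext i; cases i <;> simp
    rw [this, sumElim_dotProduct_sumElim]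
    simp only [Function.comp_def, Sum.elim_inl, Sum.elim_inr]
    simp only [mulVec_neg, dotProduct_add, neg_dotProduct, dotProduct_neg]
    ring
  rw [hexp, e3, e1, e2, e4] at hq
  have h1 := (Complex.le_def.1 hq).1
  have h2 := Complex.lt_def.1 hδ
  have h3 : (star u ⬝ᵥ w).im = 0 := h2.2.symm
  simp only [Complex.sub_re, Complex.add_re, Complex.star_def, Complex.conj_re, Complex.zero_re,
    Complex.mul_re, Complex.ofReal_re, Complex.ofReal_im, h3] at h1
  have h4 : 0 < (star u ⬝ᵥ w).re := h2.1
  nlinarith [mul_pos_of_neg_of_neg hneg (neg_neg_of_pos h4)]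

/-- For commuting positive semidefinite `V`, `W`: if `[[V², X], [X, W²]]` is positive semidefinite,
then `X ≤ V W`. -/
theorem PosSemidef.le_mul_of_fromBlocks [DecidableEq ι] {V W X : Matrix ι ι ℂ} (hV : V.PosSemidef)
    (hW : W.PosSemidef) (hVW : Commute V W) (hX : X.IsHermitian)
    (h : (fromBlocks (V * V) X X (W * W)).PosSemidef) : X ≤ V * W := by
  -- Shifting `V` and `W` by `ε` makes them positive definite and only enlarges the diagonal blocks
  -- `V²`, `W²`, so the definite case applies; then `ε → 0`.
  have key : ∀ ε : ℝ, 0 < ε →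
      ((V + (ε : ℂ) • 1) * (W + (ε : ℂ) • 1) - X).PosSemidef := by
    intro ε hε
    have hε' : (0 : ℂ) < ε := by exact_mod_cast hε
    have h1 : ((ε : ℂ) • (1 : Matrix ι ι ℂ)).PosDef := PosDef.one.smul hε'
    have hext : ∀ Z : Matrix ι ι ℂ, Z.PosSemidef →
        ((Z + (ε : ℂ) • 1) * (Z + (ε : ℂ) • 1) - Z * Z).PosSemidef := by
      intro Z hZ
      have : (Z + (ε : ℂ) • 1) * (Z + (ε : ℂ) • 1) - Z * Z
          = (2 * ε : ℂ) • Z + (ε * ε : ℂ) • 1 := by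
        simp only [add_mul, mul_add, smul_mul_assoc, mul_smul_comm, one_mul, mul_one]
        module
      rw [this]
      exact (hZ.smul (by positivity)).add (PosSemidef.one.smul (by positivity))
    refine le_iff.1 (PosDef.le_mul_of_fromBlocks (PosDef.posSemidef_add hV h1)
      (PosDef.posSemidef_add hW h1) ?_ hX ?_)
    · exact (hVW.add_left ((Commute.one_left _).smul_left _)).add_right
        ((Commute.one_right _).smul_right _)
    · exact h.fromBlocks_mono (le_iff.2 (hext V hV)) (le_iff.2 (hext W hW))
  rw [le_iff]
  have hlim : Filter.Tendsto
      (fun ε : ℝ => (V + (ε : ℂ) • 1) * (W + (ε : ℂ) • 1) - X) (nhdsWithin 0 (Set.Ioi 0))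
      (nhds (V * W - X)) := by
    have : Continuous fun ε : ℝ => (V + (ε : ℂ) • 1) * (W + (ε : ℂ) • 1) - X := by fun_prop
    have h0 := this.tendsto 0
    simp only [Complex.ofReal_zero, zero_smul, add_zero] at h0
    exact h0.mono_left nhdsWithin_le_nhds
  exact isClosed_posSemidef.mem_of_tendsto hlim
    (by filter_upwards [self_mem_nhdsWithin] with ε hε using key ε hε)

end Matrix

/-! ## Powers of positive semidefinite matrices -/

section MatPow

variable {n : ℕ} {A B : Matrix (Fin n) (Fin n) ℂ}

theorem Matrix.PosSemidef.nonneg_of_mem_spectrum (hA : A.PosSemidef) {t : ℝ}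
    (ht : t ∈ spectrum ℝ A) : 0 ≤ t :=
  spectrum_nonneg_of_nonneg (Matrix.nonneg_iff_posSemidef.2 hA) ht

theorem matPow_posSemidef (hA : A.PosSemidef) (s : ℝ) : (matPow A s).PosSemidef :=
  Matrix.nonneg_iff_posSemidef.1 <| cfc_nonneg fun _ ht =>
    Real.rpow_nonneg (hA.nonneg_of_mem_spectrum ht) s

theorem matPow_mul (hA : A.PosSemidef) {s t : ℝ} (hs : 0 ≤ s) (ht : 0 ≤ t) :
    matPow A s * matPow A t = matPow A (s + t) := by
  have hA' : IsSelfAdjoint A := hA.1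
  rw [matPow, matPow, ← cfc_mul _ _ A (Real.continuous_rpow_const hs).continuousOn
    (Real.continuous_rpow_const ht).continuousOn]
  exact cfc_congr fun x hx =>
    (Real.rpow_add_of_nonneg (hA.nonneg_of_mem_spectrum hx) hs ht).symm

theorem matPow_zero (hA : A.PosSemidef) : matPow A 0 = 1 := by
  have hA' : IsSelfAdjoint A := hA.1
  simp only [matPow, Real.rpow_zero]
  exact cfc_const_one ℝ A

theorem matPow_one (hA : A.PosSemidef) : matPow A 1 = A := by
  have hA' : IsSelfAdjoint A := hA.1
  simp only [matPow, Real.rpow_one]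
  exact cfc_id' ℝ A

/-- The scalar inequality `t ^ s ≤ 1 + t` has a right side free of `s`; this uniformity is what
dominated convergence in the exponent needs. -/
theorem matPow_le (hA : A.PosSemidef) {s : ℝ} (hs : 0 ≤ s) (hs' : s ≤ 1) :
    matPow A s ≤ 1 + A := by
  have hA' : IsSelfAdjoint A := hA.1
  have h1 : (1 : Matrix (Fin n) (Fin n) ℂ) + A = cfc (fun t : ℝ => 1 + t) A := by
    rw [cfc_const_add 1 (fun t : ℝ => t) A (by fun_prop) hA', cfc_id' ℝ A]; simp
  rw [h1]
  refine (cfc_le_iff _ _ A (Real.continuous_rpow_const hs).continuousOn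
    (by fun_prop)).2 fun t ht => ?_
  have ht0 := hA.nonneg_of_mem_spectrum ht
  rcases le_total t 1 with h | h
  · exact (Real.rpow_le_one ht0 h hs).trans (by linarith)
  · calc t ^ s ≤ t ^ (1 : ℝ) := Real.rpow_le_rpow_of_exponent_le h hs'
      _ ≤ 1 + t := by rw [Real.rpow_one]; linarith

theorem norm_matPow_apply_le (hA : A.PosSemidef) {s : ℝ} (hs : 0 ≤ s) (hs' : s ≤ 1)
    (i j : Fin n) : ‖matPow A s i j‖ ≤ n + A.trace.re := by
  refine ((matPow_posSemidef hA s).norm_apply_le i j).trans ?_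
  have h := (Matrix.le_iff.1 (matPow_le hA hs hs')).trace_nonneg
  have := (Complex.le_def.1 h).1
  simp [Matrix.trace_sub, Matrix.trace_add] at this
  linarith

/-- The diagonalization of `A` does not depend on the exponent, so only the eigenvalue powers move.
The exponent `0` is excluded because `0 ^ t` jumps there. -/
theorem tendsto_matPow (hA : A.PosSemidef) {s : ℝ} (hs : 0 < s) :
    Filter.Tendsto (fun t => matPow A t) (nhds s) (nhds (matPow A s)) := by
  have h : ∀ t, matPow A t = (hA.1.eigenvectorUnitary : Matrix (Fin n) (Fin n) ℂ) *
      Matrix.diagonal (fun i => ((hA.1.eigenvalues i ^ t : ℝ) : ℂ)) *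
      star (hA.1.eigenvectorUnitary : Matrix (Fin n) (Fin n) ℂ) := fun t => by
    rw [matPow, hA.1.cfc_eq, Matrix.IsHermitian.cfc, Unitary.conjStarAlgAut_apply]
    rfl
  simp only [h]
  have hd : Filter.Tendsto
      (fun t => Matrix.diagonal (fun i => ((hA.1.eigenvalues i ^ t : ℝ) : ℂ))) (nhds s)
      (nhds (Matrix.diagonal (fun i => ((hA.1.eigenvalues i ^ s : ℝ) : ℂ)))) := by
    refine (Continuous.matrix_diagonal continuous_id).continuousAt.tendsto.comp
      (tendsto_pi_nhds.2 fun i => ?_)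
    refine (Complex.continuous_ofReal.tendsto _).comp ?_
    exact Real.continuousAt_const_rpow' hs.ne'
  exact (tendsto_const_nhds.mul hd).mul tendsto_const_nhds

-- Continuity in the matrix at a fixed exponent; it serves to show that `x ↦ A(x)^s` is measurable.
open scoped Matrix.Norms.L2Operator in
theorem continuousOn_matPow {s : ℝ} (hs : 0 ≤ s) :
    ContinuousOn (fun A : Matrix (Fin n) (Fin n) ℂ => matPow A s) {A | IsSelfAdjoint A} := by
  unfold matPow
  exact ContinuousOn.cfc_of_mem_nhdsSet (s := Set.univ) (fun t : ℝ => t ^ s) Filter.univ_mem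
    continuousOn_id (fun _ h => h) (Real.continuous_rpow_const hs).continuousOn

/-- The matrix of the operator `ξ ↦ A^s ξ B^t` on `n × n` matrices. -/
noncomputable def powKron (A B : Matrix (Fin n) (Fin n) ℂ) (s t : ℝ) :
    Matrix (Fin n × Fin n) (Fin n × Fin n) ℂ :=
  Matrix.kroneckerMap (· * ·) (matPow A s) (matPow B t).transpose

theorem powKron_apply (s t : ℝ) (p q : Fin n × Fin n) :
    powKron A B s t p q = matPow A s p.1 q.1 * matPow B t q.2 p.2 := rfl

theorem powKron_posSemidef (hA : A.PosSemidef) (hB : B.PosSemidef) (s t : ℝ) :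
    (powKron A B s t).PosSemidef :=
  (matPow_posSemidef hA s).kronecker (matPow_posSemidef hB t).transpose

theorem powKron_mul (hA : A.PosSemidef) (hB : B.PosSemidef) {s t s' t' : ℝ} (hs : 0 ≤ s)
    (ht : 0 ≤ t) (hs' : 0 ≤ s') (ht' : 0 ≤ t') :
    powKron A B s t * powKron A B s' t' = powKron A B (s + s') (t + t') := by
  unfold powKron
  rw [← Matrix.mul_kronecker_mul, matPow_mul hA hs hs', ← Matrix.transpose_mul,
    matPow_mul hB ht' ht, add_comm t' t]

theorem powKron_commute (hA : A.PosSemidef) (hB : B.PosSemidef) {s t s' t' : ℝ} (hs : 0 ≤ s)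
    (ht : 0 ≤ t) (hs' : 0 ≤ s') (ht' : 0 ≤ t') :
    Commute (powKron A B s t) (powKron A B s' t') := by
  rw [Commute, SemiconjBy, powKron_mul hA hB hs ht hs' ht', powKron_mul hA hB hs' ht' hs ht,
    add_comm s, add_comm t]

/-- The block matrix is `R* R` for the block row `R = [powKron A B s t, powKron A B s' t']`: the
factors are Hermitian and multiply by adding exponents. -/
theorem powKron_fromBlocks_posSemidef (hA : A.PosSemidef) (hB : B.PosSemidef) {s t s' t' : ℝ}
    (hs : 0 ≤ s) (ht : 0 ≤ t) (hs' : 0 ≤ s') (ht' : 0 ≤ t') :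
    (Matrix.fromBlocks (powKron A B (2 * s) (2 * t)) (powKron A B (s + s') (t + t'))
      (powKron A B (s + s') (t + t')) (powKron A B (2 * s') (2 * t'))).PosSemidef := by
  have h := Matrix.posSemidef_conjTranspose_mul_self
    (Matrix.fromCols (powKron A B s t) (powKron A B s' t'))
  rw [Matrix.conjTranspose_fromCols_eq_fromRows_conjTranspose, Matrix.fromRows_mul_fromCols,
    (powKron_posSemidef hA hB s t).1.eq, (powKron_posSemidef hA hB s' t').1.eq,
    powKron_mul hA hB hs ht hs ht, powKron_mul hA hB hs ht hs' ht',
    powKron_mul hA hB hs' ht' hs ht, powKron_mul hA hB hs' ht' hs' ht'] at h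
  convert h using 2 <;> congr 1 <;> ring

theorem norm_powKron_apply_le (hA : A.PosSemidef) (hB : B.PosSemidef) {s t : ℝ} (hs : 0 ≤ s)
    (hs' : s ≤ 1) (ht : 0 ≤ t) (ht' : t ≤ 1) (p q : Fin n × Fin n) :
    ‖powKron A B s t p q‖ ≤ (n + A.trace.re) * (n + B.trace.re) := by
  rw [powKron_apply, norm_mul]
  exact mul_le_mul (norm_matPow_apply_le hA hs hs' _ _) (norm_matPow_apply_le hB ht ht' _ _)
    (norm_nonneg _) ((norm_nonneg _).trans (norm_matPow_apply_le hA hs hs' p.1 q.1))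

theorem tendsto_powKron_apply (hA : A.PosSemidef) (hB : B.PosSemidef) {s : ℝ} (hs : 0 < s)
    (hs' : s < 1) (p q : Fin n × Fin n) :
    Filter.Tendsto (fun t => powKron A B t (1 - t) p q) (nhds s)
      (nhds (powKron A B s (1 - s) p q)) := by
  have h1 := tendsto_matPow hA hs
  have h2 := (tendsto_matPow hB (sub_pos.2 hs')).comp
    ((continuous_const.sub continuous_id).tendsto s)
  have e1 := (tendsto_pi_nhds.1 (tendsto_pi_nhds.1 h1 p.1)) q.1
  have e2 := (tendsto_pi_nhds.1 (tendsto_pi_nhds.1 h2 q.2)) p.2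
  exact e1.mul e2

end MatPow

/-! ## Positive linear maps on bounded functions -/

section PositiveMap

variable {Ω : Type*} [MeasurableSpace Ω] {μ : Measure Ω} {p : ℝ≥0∞}

theorem toLpClass_coeFn {f : Ω → ℂ} (hf : MemLp f p μ) : toLpClass p μ f =ᵐ[μ] f := by
  rw [toLpClass, dif_pos hf]
  exact hf.coeFn_toLp

theorem toLpClass_congr {f g : Ω → ℂ} (hf : MemLp f p μ) (h : f =ᵐ[μ] g) :
    toLpClass p μ f = toLpClass p μ g := by
  ext1
  exact (toLpClass_coeFn hf).trans (h.trans (toLpClass_coeFn (hf.ae_eq h)).symm)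

theorem toLpClass_sum {κ : Type*} (s : Finset κ) (c : κ → ℂ) {f : κ → Ω → ℂ}
    (hf : ∀ k, MemLp (f k) p μ) :
    toLpClass p μ (fun x => ∑ k ∈ s, c k * f k x) = ∑ k ∈ s, c k • toLpClass p μ (f k) := by
  have hm : MemLp (fun x => ∑ k ∈ s, c k * f k x) p μ :=
    memLp_finsetSum s fun k _ => (hf k).const_mul (c k)
  ext1
  refine (toLpClass_coeFn hm).trans (Filter.EventuallyEq.trans ?_ (Lp.coeFn_finsetSum s _).symm)
  have h1 : ∀ᵐ x ∂μ, ∀ k ∈ s, (c k • toLpClass p μ (f k) : Lp ℂ p μ) x = c k * f k x := by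
    refine (Filter.eventually_all_finset s).2 fun k _ => ?_
    filter_upwards [Lp.coeFn_smul (c k) (toLpClass p μ (f k)), toLpClass_coeFn (hf k)] with x h h'
    rw [h, Pi.smul_apply, h', smul_eq_mul]
  filter_upwards [h1] with x hx
  rw [Finset.sum_apply]
  exact Finset.sum_congr rfl fun k hk => (hx k hk).symm

theorem LinearMap.toLpClass_sum_ae (T : Lp ℂ ∞ μ →ₗ[ℂ] Lp ℂ p μ) {κ : Type*} (s : Finset κ)
    (c : κ → ℂ) {f : κ → Ω → ℂ} (hf : ∀ k, MemLp (f k) ∞ μ) :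
    T (toLpClass ∞ μ (fun x => ∑ k ∈ s, c k * f k x)) =ᵐ[μ]
      fun x => ∑ k ∈ s, c k * T (toLpClass ∞ μ (f k)) x := by
  rw [toLpClass_sum s c hf, map_sum]
  have h1 : ∀ᵐ x ∂μ, ∀ k ∈ s,
      (T (c k • toLpClass ∞ μ (f k))) x = c k * T (toLpClass ∞ μ (f k)) x := by
    refine (Filter.eventually_all_finset s).2 fun k _ => ?_
    rw [map_smul]
    filter_upwards [Lp.coeFn_smul (c k) (T (toLpClass ∞ μ (f k)))] with x h
    rw [h, Pi.smul_apply, smul_eq_mul]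
  filter_upwards [h1, Lp.coeFn_finsetSum s fun k => T (c k • toLpClass ∞ μ (f k))] with x hx h
  rw [h, Finset.sum_apply]
  exact Finset.sum_congr rfl fun k hk => hx k hk

/-- Entrywise application of `T : L^∞ → L^p` to a matrix-valued bounded function. -/
noncomputable def mapEntries (T : Lp ℂ ∞ μ →ₗ[ℂ] Lp ℂ p μ) {ι : Type*} (F : Ω → Matrix ι ι ℂ)
    (x : Ω) : Matrix ι ι ℂ :=
  Matrix.of fun i j => T (toLpClass ∞ μ (fun y => F y i j)) x

/-- `T : L^∞ → L^p` is positive and unital. -/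
structure IsPositiveUnital [IsFiniteMeasure μ] (T : Lp ℂ ∞ μ →ₗ[ℂ] Lp ℂ p μ) : Prop where
  map_one : T (Lp.const ∞ μ (1 : ℂ)) =ᵐ[μ] fun _ => 1
  map_nonneg : ∀ f : Lp ℂ ∞ μ, (∀ᵐ x ∂μ, 0 ≤ f x) → ∀ᵐ x ∂μ, 0 ≤ T f x

variable {ι : Type*} [Fintype ι]

theorem mapEntries_sum_sum (T : Lp ℂ ∞ μ →ₗ[ℂ] Lp ℂ p μ) {F : Ω → Matrix ι ι ℂ}
    (hF : ∀ i j, MemLp (fun x => F x i j) ∞ μ) (c : ι → ι → ℂ) :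
    T (toLpClass ∞ μ (fun x => ∑ i, ∑ j, c i j * F x i j)) =ᵐ[μ]
      fun x => ∑ i, ∑ j, c i j * mapEntries T F x i j := by
  have h := T.toLpClass_sum_ae (Finset.univ : Finset (ι × ι)) (fun k => c k.1 k.2)
    (f := fun k x => F x k.1 k.2) fun k => hF k.1 k.2
  simp only [Fintype.sum_prod_type] at h
  exact h

theorem mapEntries_trace_ae (T : Lp ℂ ∞ μ →ₗ[ℂ] Lp ℂ p μ) {F : Ω → Matrix ι ι ℂ}
    (hF : ∀ i j, MemLp (fun x => F x i j) ∞ μ) :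
    T (toLpClass ∞ μ fun x => (F x).trace) =ᵐ[μ] fun x => (mapEntries T F x).trace := by
  have := T.toLpClass_sum_ae (Finset.univ : Finset ι) (fun _ => 1) (f := fun i x => F x i i)
    fun i => hF i i
  simp only [one_mul] at this
  exact this

variable [IsFiniteMeasure μ] {T : Lp ℂ ∞ μ →ₗ[ℂ] Lp ℂ p μ}

theorem IsPositiveUnital.nonneg (hT : IsPositiveUnital T) {f : Ω → ℂ} (hf : MemLp f ∞ μ)
    (h : ∀ᵐ x ∂μ, 0 ≤ f x) : ∀ᵐ x ∂μ, 0 ≤ T (toLpClass ∞ μ f) x := by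
  refine hT.map_nonneg _ ?_
  filter_upwards [toLpClass_coeFn hf, h] with x h1 h2
  rwa [h1]

theorem IsPositiveUnital.apply_const (hT : IsPositiveUnital T) (c : ℂ) :
    T (toLpClass ∞ μ (fun _ => c)) =ᵐ[μ] fun _ => c := by
  have h : toLpClass ∞ μ (fun _ : Ω => c) = c • Lp.const ∞ μ (1 : ℂ) := by
    ext1
    filter_upwards [toLpClass_coeFn (p := ∞) (memLp_const (μ := μ) c),
      Lp.coeFn_smul c (Lp.const ∞ μ (1 : ℂ)), Lp.coeFn_const (p := ∞) (μ := μ) (1 : ℂ)]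
      with x h1 h2 h3
    rw [h1, h2, Pi.smul_apply, h3]; simp
  rw [h, map_smul]
  filter_upwards [Lp.coeFn_smul c (T (Lp.const ∞ μ (1 : ℂ))), hT.map_one] with x h1 h2
  rw [h1, Pi.smul_apply, h2]; simp

/-- Positive maps of commutative algebras are completely positive. -/
theorem IsPositiveUnital.mapEntries_posSemidef (hT : IsPositiveUnital T) {F : Ω → Matrix ι ι ℂ}
    (hF : ∀ i j, MemLp (fun x => F x i j) ∞ μ) (hpos : ∀ᵐ x ∂μ, (F x).PosSemidef) :
    ∀ᵐ x ∂μ, (mapEntries T F x).PosSemidef := by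
  have key : ∀ c : ι → ℂ, ∀ᵐ x ∂μ, 0 ≤ star c ⬝ᵥ (mapEntries T F x).mulVec c := by
    intro c
    have hm : MemLp (fun x => ∑ i, ∑ j, star (c i) * c j * F x i j) ∞ μ :=
      memLp_finsetSum _ fun i _ => memLp_finsetSum _ fun j _ => (hF i j).const_mul _
    have h0 := hT.nonneg hm (by
      filter_upwards [hpos] with x hx
      rw [← Matrix.dotProduct_mulVec_eq_sum]
      exact hx.dotProduct_mulVec_nonneg c)
    filter_upwards [h0, mapEntries_sum_sum T hF fun i j => star (c i) * c j] with x h1 h2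
    rw [Matrix.dotProduct_mulVec_eq_sum, ← h2]
    exact h1
  filter_upwards [ae_all_iff.2 fun i : ℕ =>
    key (TopologicalSpace.denseSeq (ι → ℂ) i)] with x hx
  exact .of_forall_denseSeq hx

/-- Positivity applied to `R - tr F ≥ 0`, together with `T R = R`. -/
theorem IsPositiveUnital.mapEntries_trace_le (hT : IsPositiveUnital T) {F : Ω → Matrix ι ι ℂ}
    (hF : ∀ i j, MemLp (fun x => F x i j) ∞ μ) {R : ℝ} (hR : ∀ᵐ x ∂μ, (F x).trace ≤ (R : ℂ)) :
    ∀ᵐ x ∂μ, (mapEntries T F x).trace ≤ (R : ℂ) := by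
  have hm : MemLp (fun x => (F x).trace) ∞ μ := memLp_finsetSum _ fun i _ => hF i i
  -- The difference `R - tr F` is encoded as a linear combination indexed by `Bool` with
  -- coefficients `1` and `-1`.
  have h := T.toLpClass_sum_ae (Finset.univ : Finset Bool) (fun b => cond b 1 (-1))
    (f := fun b x => cond b (R : ℂ) (F x).trace) (by
      rintro (_ | _)
      · exact hm
      · exact memLp_const _)
  simp only [Fintype.sum_bool, cond_true, cond_false, one_mul, neg_mul, ← sub_eq_add_neg] at h
  have h0 := hT.nonneg (f := fun x => (R : ℂ) - (F x).trace) ((memLp_const _).sub hm) (by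
    filter_upwards [hR] with x hx
    exact sub_nonneg.2 hx)
  filter_upwards [h, h0, hT.apply_const (R : ℂ),
    mapEntries_trace_ae T hF] with x h1 h2 h3 h4
  rw [h1, h3, h4] at h2
  exact sub_nonneg.1 h2

end PositiveMap

/-! ## Jensen's inequality for `(A, B) ↦ A^s ⊗ B^(1-s)` -/

section Jensen

variable {Ω : Type*} [MeasurableSpace Ω] {μ : Measure Ω} {p : ℝ≥0∞}

/-- `F` is essentially bounded and almost everywhere positive semidefinite. -/
structure IsBoundedPosSemidef (μ : Measure Ω) {ι : Type*} (F : Ω → Matrix ι ι ℂ) : Prop where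
  memLp : ∀ i j, MemLp (fun x => F x i j) ∞ μ
  posSemidef : ∀ᵐ x ∂μ, (F x).PosSemidef

theorem IsBoundedPosSemidef.exists_trace_le {ι : Type*} [Fintype ι] {F : Ω → Matrix ι ι ℂ}
    (hF : IsBoundedPosSemidef μ F) : ∃ R : ℝ, ∀ᵐ x ∂μ, (F x).trace ≤ (R : ℂ) := by
  have hm : MemLp (fun x => (F x).trace) ∞ μ := memLp_finsetSum _ fun i _ => hF.memLp i i
  refine ⟨(eLpNormEssSup (fun x => (F x).trace) μ).toReal, ?_⟩
  have hlt : eLpNormEssSup (fun x => (F x).trace) μ < (⊤ : ℝ≥0∞) := by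
    rw [← eLpNorm_exponent_top]; exact hm.2
  filter_upwards [hF.posSemidef, ae_le_eLpNormEssSup (f := fun x => (F x).trace) (μ := μ)]
    with x hx h
  have h0 := hx.trace_nonneg
  have h1 : (0 : ℝ) ≤ (F x).trace.re := (Complex.le_def.1 h0).1
  have h2 : (F x).trace = ((F x).trace.re : ℂ) :=
    Complex.ext rfl (by simpa using (Complex.le_def.1 h0).2.symm)
  rw [h2, ← ofReal_norm, Complex.norm_real, Real.norm_of_nonneg h1] at h
  rw [h2, Complex.real_le_real]
  exact (ENNReal.ofReal_le_iff_le_toReal hlt.ne).1 h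

/-- The power is continuous on the closed set of self-adjoint matrices; extended by zero it is a
Borel function, and composing with it preserves almost everywhere measurability. -/
theorem aestronglyMeasurable_matPow_apply {n : ℕ} {F : Ω → Matrix (Fin n) (Fin n) ℂ}
    (hF : ∀ i j, AEStronglyMeasurable (fun x => F x i j) μ) (hpos : ∀ᵐ x ∂μ, (F x).PosSemidef)
    {s : ℝ} (hs : 0 ≤ s) (i j : Fin n) :
    AEStronglyMeasurable (fun x => matPow (F x) s i j) μ := by
  classical
  let S : Set (Fin n → Fin n → ℂ) := {A | IsSelfAdjoint (Matrix.of A)}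
  have hS : IsClosed S := by
    have : Continuous fun A : Fin n → Fin n → ℂ => star (Matrix.of A) :=
      Continuous.star (continuous_id (X := Matrix (Fin n) (Fin n) ℂ))
    exact isClosed_eq this continuous_id
  let φ : (Fin n → Fin n → ℂ) → ℂ := fun A => matPow (Matrix.of A) s i j
  have hφ : ContinuousOn φ S := by
    have h1 := continuousOn_matPow (n := n) hs
    exact (continuous_apply_apply i j).comp_continuousOn h1
  have hm : Measurable (S.piecewise φ fun _ => 0) :=
    hφ.measurable_piecewise continuousOn_const hS.measurableSet
  have hFm : AEMeasurable (fun x (k l : Fin n) => F x k l) μ :=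
    aemeasurable_pi_iff.2 fun k => aemeasurable_pi_iff.2 fun l => (hF k l).aemeasurable
  refine (hm.comp_aemeasurable hFm).aestronglyMeasurable.congr ?_
  filter_upwards [hpos] with x hx
  exact Set.piecewise_eq_of_mem _ _ _ hx.1

variable {n : ℕ} {A B : Ω → Matrix (Fin n) (Fin n) ℂ}

theorem IsBoundedPosSemidef.powKron (hA : IsBoundedPosSemidef μ A) (hB : IsBoundedPosSemidef μ B)
    {s t : ℝ} (hs : 0 ≤ s) (hs' : s ≤ 1) (ht : 0 ≤ t) (ht' : t ≤ 1) :
    IsBoundedPosSemidef μ (fun x => powKron (A x) (B x) s t) := by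
  obtain ⟨R, hR⟩ := hA.exists_trace_le
  obtain ⟨R', hR'⟩ := hB.exists_trace_le
  refine ⟨fun i j => memLp_top_of_bound ?_ ((n + R) * (n + R')) ?_, ?_⟩
  · simp only [powKron_apply]
    exact (aestronglyMeasurable_matPow_apply (fun i j => (hA.memLp i j).1) hA.posSemidef hs _ _).mul
      (aestronglyMeasurable_matPow_apply (fun i j => (hB.memLp i j).1) hB.posSemidef ht _ _)
  · filter_upwards [hA.posSemidef, hB.posSemidef, hR, hR'] with x h1 h2 h3 h4
    refine (norm_powKron_apply_le h1 h2 hs hs' ht ht' i j).trans ?_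
    have e1 := (Complex.le_def.1 h3).1
    have e2 := (Complex.le_def.1 h4).1
    have e3 := (Complex.le_def.1 h1.trace_nonneg).1
    have e4 := (Complex.le_def.1 h2.trace_nonneg).1
    simp only [Complex.ofReal_re, Complex.zero_re] at e1 e2 e3 e4
    have := Nat.cast_nonneg (α := ℝ) n
    gcongr
    linarith
  · filter_upwards [hA.posSemidef, hB.posSemidef] with x h1 h2
    exact powKron_posSemidef h1 h2 s t

theorem LinearMap.toLpClass_const_mul_ae (T : Lp ℂ ∞ μ →ₗ[ℂ] Lp ℂ p μ) (c : ℂ) {f : Ω → ℂ}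
    (hf : MemLp f ∞ μ) : T (toLpClass ∞ μ (fun x => c * f x)) =ᵐ[μ]
      fun x => c * T (toLpClass ∞ μ f) x := by
  simpa using T.toLpClass_sum_ae (Finset.univ : Finset Unit) (fun _ => c) (f := fun _ => f)
    fun _ => hf

variable [IsFiniteMeasure μ] {T : Lp ℂ ∞ μ →ₗ[ℂ] Lp ℂ p μ}

/-- Although `T` only lands in `L^p`, boundedness survives: the image is positive semidefinite and
its trace keeps the same bound, which controls all entries. -/
theorem IsBoundedPosSemidef.mapEntries {ι : Type*} [Fintype ι] {F : Ω → Matrix ι ι ℂ}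
    (hF : IsBoundedPosSemidef μ F) (hT : IsPositiveUnital T) :
    IsBoundedPosSemidef μ (mapEntries T F) := by
  have hpos := hT.mapEntries_posSemidef hF.memLp hF.posSemidef
  obtain ⟨R, hR⟩ := hF.exists_trace_le
  refine ⟨fun i j => memLp_top_of_bound (Lp.aestronglyMeasurable _) R ?_, hpos⟩
  filter_upwards [hpos, hT.mapEntries_trace_le hF.memLp hR] with x h1 h2
  exact (h1.norm_apply_le i j).trans (Complex.le_def.1 h2).1

/-- At an endpoint exponent one tensor factor is the identity, so the kernel is linear in the other
matrix and commutes with `T` exactly. -/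
theorem IsPositiveUnital.jensen_zero (hT : IsPositiveUnital T) (hA : IsBoundedPosSemidef μ A)
    (hB : IsBoundedPosSemidef μ B) :
    ∀ᵐ x ∂μ, mapEntries T (fun y => powKron (A y) (B y) 0 1) x =
      powKron (mapEntries T A x) (mapEntries T B x) 0 1 := by
  have h : ∀ q r : Fin n × Fin n, ∀ᵐ x ∂μ, mapEntries T (fun y => powKron (A y) (B y) 0 1) x q r =
      (1 : Matrix (Fin n) (Fin n) ℂ) q.1 r.1 * mapEntries T B x r.2 q.2 := by
    intro q r
    have h1 : toLpClass ∞ μ (fun y => powKron (A y) (B y) 0 1 q r) =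
        toLpClass ∞ μ (fun y => (1 : Matrix (Fin n) (Fin n) ℂ) q.1 r.1 * B y r.2 q.2) := by
      refine toLpClass_congr ((hA.powKron hB le_rfl zero_le_one zero_le_one le_rfl).memLp q r) ?_
      filter_upwards [hA.posSemidef, hB.posSemidef] with x hx hx'
      rw [powKron_apply, matPow_zero hx, matPow_one hx']
    filter_upwards [T.toLpClass_const_mul_ae ((1 : Matrix (Fin n) (Fin n) ℂ) q.1 r.1)
      (hB.memLp r.2 q.2)] with x hx
    simp only [mapEntries, Matrix.of_apply, h1]
    exact hx
  filter_upwards [ae_all_iff.2 fun q => ae_all_iff.2 fun r => h q r,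
    (hA.mapEntries hT).posSemidef, (hB.mapEntries hT).posSemidef] with x hx h1 h2
  ext q r
  rw [hx, powKron_apply, matPow_zero h1, matPow_one h2]

theorem IsPositiveUnital.jensen_one (hT : IsPositiveUnital T) (hA : IsBoundedPosSemidef μ A)
    (hB : IsBoundedPosSemidef μ B) :
    ∀ᵐ x ∂μ, mapEntries T (fun y => powKron (A y) (B y) 1 0) x =
      powKron (mapEntries T A x) (mapEntries T B x) 1 0 := by
  have h : ∀ q r : Fin n × Fin n, ∀ᵐ x ∂μ, mapEntries T (fun y => powKron (A y) (B y) 1 0) x q r =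
      (1 : Matrix (Fin n) (Fin n) ℂ) r.2 q.2 * mapEntries T A x q.1 r.1 := by
    intro q r
    have h1 : toLpClass ∞ μ (fun y => powKron (A y) (B y) 1 0 q r) =
        toLpClass ∞ μ (fun y => (1 : Matrix (Fin n) (Fin n) ℂ) r.2 q.2 * A y q.1 r.1) := by
      refine toLpClass_congr ((hA.powKron hB zero_le_one le_rfl le_rfl zero_le_one).memLp q r) ?_
      filter_upwards [hA.posSemidef, hB.posSemidef] with x hx hx'
      rw [powKron_apply, matPow_one hx, matPow_zero hx', mul_comm]
    filter_upwards [T.toLpClass_const_mul_ae ((1 : Matrix (Fin n) (Fin n) ℂ) r.2 q.2)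
      (hA.memLp q.1 r.1)] with x hx
    simp only [mapEntries, Matrix.of_apply, h1]
    exact hx
  filter_upwards [ae_all_iff.2 fun q => ae_all_iff.2 fun r => h q r,
    (hA.mapEntries hT).posSemidef, (hB.mapEntries hT).posSemidef] with x hx h1 h2
  ext q r
  rw [hx, powKron_apply, matPow_one h1, matPow_zero h2, mul_comm]

/-- Complete positivity keeps the block matrix of the three kernels positive after applying `T`. The
assumed bounds replace its diagonal by kernels of `T A`, `T B`, which commute and are perfect
squares, and the off-diagonal block is then at most the product of their roots. -/
theorem IsPositiveUnital.jensen_midpoint (hT : IsPositiveUnital T) (hA : IsBoundedPosSemidef μ A)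
    (hB : IsBoundedPosSemidef μ B) {s t : ℝ} (hs : 0 ≤ s) (hs' : s ≤ 1) (ht : 0 ≤ t) (ht' : t ≤ 1)
    (h1 : ∀ᵐ x ∂μ, mapEntries T (fun y => powKron (A y) (B y) s (1 - s)) x ≤
      powKron (mapEntries T A x) (mapEntries T B x) s (1 - s))
    (h2 : ∀ᵐ x ∂μ, mapEntries T (fun y => powKron (A y) (B y) t (1 - t)) x ≤
      powKron (mapEntries T A x) (mapEntries T B x) t (1 - t)) :
    ∀ᵐ x ∂μ, mapEntries T (fun y => powKron (A y) (B y) ((s + t) / 2) (1 - (s + t) / 2)) x ≤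
      powKron (mapEntries T A x) (mapEntries T B x) ((s + t) / 2) (1 - (s + t) / 2) := by
  have m1 := hA.powKron hB hs hs' (sub_nonneg.2 hs') (sub_le_self 1 hs)
  have m2 := hA.powKron hB ht ht' (sub_nonneg.2 ht') (sub_le_self 1 ht)
  have m3 := hA.powKron hB (s := (s + t) / 2) (t := 1 - (s + t) / 2) (by linarith) (by linarith)
    (by linarith) (by linarith)
  have hblock := hT.mapEntries_posSemidef (F := fun y => Matrix.fromBlocks
      (powKron (A y) (B y) s (1 - s)) (powKron (A y) (B y) ((s + t) / 2) (1 - (s + t) / 2))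
      (powKron (A y) (B y) ((s + t) / 2) (1 - (s + t) / 2)) (powKron (A y) (B y) t (1 - t)))
    (by
      rintro (i | i) (j | j)
      · exact m1.memLp i j
      · exact m3.memLp i j
      · exact m3.memLp i j
      · exact m2.memLp i j)
    (by
      filter_upwards [hA.posSemidef, hB.posSemidef] with x hx hx'
      have := powKron_fromBlocks_posSemidef hx hx' (s := s / 2) (t := (1 - s) / 2) (s' := t / 2)
        (t' := (1 - t) / 2) (by linarith) (by linarith) (by linarith) (by linarith)
      convert this using 2 <;> congr 1 <;> ring)
  filter_upwards [h1, h2, hblock, (hA.mapEntries hT).posSemidef, (hB.mapEntries hT).posSemidef,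
    (m3.mapEntries hT).posSemidef] with x h1 h2 h3 h4 h5 h6
  have e : ∀ F11 F12 F21 F22 : Ω → Matrix (Fin n × Fin n) (Fin n × Fin n) ℂ,
      mapEntries T (fun y => Matrix.fromBlocks (F11 y) (F12 y) (F21 y) (F22 y)) x =
      Matrix.fromBlocks (mapEntries T F11 x) (mapEntries T F12 x) (mapEntries T F21 x)
        (mapEntries T F22 x) := by
    intro F11 F12 F21 F22
    ext (i | i) (j | j) <;> rfl
  rw [e] at h3
  have h7 := h3.fromBlocks_mono h1 h2
  -- `V` and `W` are the square roots of the kernels at `s` and `t`; adding exponents, `V * W` is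
  -- the kernel at `(s + t) / 2`.
  set V := powKron (mapEntries T A x) (mapEntries T B x) (s / 2) ((1 - s) / 2)
  set W := powKron (mapEntries T A x) (mapEntries T B x) (t / 2) ((1 - t) / 2)
  have hV : powKron (mapEntries T A x) (mapEntries T B x) s (1 - s) = V * V := by
    rw [powKron_mul h4 h5 (by linarith) (by linarith) (by linarith) (by linarith)]
    congr 1 <;> ring
  have hW : powKron (mapEntries T A x) (mapEntries T B x) t (1 - t) = W * W := by
    rw [powKron_mul h4 h5 (by linarith) (by linarith) (by linarith) (by linarith)]
    congr 1 <;> ring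
  have hVW : powKron (mapEntries T A x) (mapEntries T B x) ((s + t) / 2) (1 - (s + t) / 2)
      = V * W := by
    rw [powKron_mul h4 h5 (by linarith) (by linarith) (by linarith) (by linarith)]
    congr 1 <;> ring
  rw [hV, hW] at h7
  rw [hVW]
  exact Matrix.PosSemidef.le_mul_of_fromBlocks (powKron_posSemidef h4 h5 _ _)
    (powKron_posSemidef h4 h5 _ _)
    (powKron_commute h4 h5 (by linarith) (by linarith) (by linarith) (by linarith)) h6.1 h7

theorem IsPositiveUnital.jensen_dyadic (hT : IsPositiveUnital T) (hA : IsBoundedPosSemidef μ A)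
    (hB : IsBoundedPosSemidef μ B) (m k : ℕ) (hk : k ≤ 2 ^ m) :
    ∀ᵐ x ∂μ, mapEntries T (fun y => powKron (A y) (B y) ((k : ℝ) / 2 ^ m) (1 - (k : ℝ) / 2 ^ m)) x ≤
      powKron (mapEntries T A x) (mapEntries T B x) ((k : ℝ) / 2 ^ m) (1 - (k : ℝ) / 2 ^ m) := by
  induction m generalizing k with
  | zero =>
    obtain rfl | rfl : k = 0 ∨ k = 1 := by simp at hk; omega
    · simpa using (hT.jensen_zero hA hB).mono fun x hx => hx.le
    · simpa using (hT.jensen_one hA hB).mono fun x hx => hx.le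
  | succ m ih =>
    have hpos : (0 : ℝ) < 2 ^ m := by positivity
    have hle : ∀ l : ℕ, l ≤ 2 ^ m → (l : ℝ) / 2 ^ m ≤ 1 := fun l hl => by
      rw [div_le_one hpos]; exact_mod_cast hl
    rw [pow_succ] at hk
    obtain ⟨l, rfl | rfl⟩ := Nat.even_or_odd' k
    · have : ((2 * l : ℕ) : ℝ) / 2 ^ (m + 1) = (l : ℝ) / 2 ^ m := by
        rw [pow_succ]; push_cast; field_simp
      rw [this]
      exact ih l (by omega)
    -- An odd numerator at level `m + 1` is the midpoint of the neighbours `l` and `l + 1` at level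
    -- `m`; the bound on `k` keeps `l + 1 ≤ 2 ^ m`.
    · have : ((2 * l + 1 : ℕ) : ℝ) / 2 ^ (m + 1)
          = ((l : ℝ) / 2 ^ m + ((l + 1 : ℕ) : ℝ) / 2 ^ m) / 2 := by
        rw [pow_succ]; push_cast; field_simp; ring
      rw [this]
      exact hT.jensen_midpoint hA hB (by positivity) (hle l (by omega)) (by positivity)
        (hle (l + 1) (by omega)) (ih l (by omega)) (ih (l + 1) (by omega))

end Jensen

/-! ## The adjoint of a Markov map on bounded functions -/

section Dagger

theorem ae_nonneg_of_forall_setIntegral {Ω : Type*} [MeasurableSpace Ω] {μ : Measure Ω}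
    {f : Ω → ℂ} (hf : Integrable f μ)
    (h : ∀ s, MeasurableSet s → 0 ≤ ∫ x in s, f x ∂μ) : ∀ᵐ x ∂μ, 0 ≤ f x := by
  have hre : 0 ≤ᵐ[μ] fun x => (f x).re :=
    ae_nonneg_of_forall_setIntegral_nonneg hf.re fun s hs _ => by
      have := (Complex.le_def.1 (h s hs)).1
      rwa [← RCLike.re_eq_complex_re, ← integral_re hf.integrableOn] at this
  have him : (fun x => (f x).im) =ᵐ[μ] fun _ => 0 :=
    Integrable.ae_eq_of_forall_setIntegral_eq _ _ hf.im (integrable_zero _ _ _)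
      fun s hs _ => by
        have := (Complex.le_def.1 (h s hs)).2
        rw [← RCLike.im_eq_complex_im, ← integral_im hf.integrableOn] at this
        simpa using this.symm
  filter_upwards [hre, him] with x h1 h2
  exact Complex.le_def.2 ⟨h1, h2.symm⟩

variable {Ω : Type*} [MeasurableSpace Ω] {μ : Measure Ω} [IsProbabilityMeasure μ]
  {P : Lp ℂ ∞ μ →ₗ[ℂ] Lp ℂ ∞ μ}

theorem IsMarkovPreserving.isPositiveUnital (hP : IsMarkovPreserving μ P) :
    IsPositiveUnital P where
  map_one := by rw [hP.map_one]; exact Lp.coeFn_const (p := ∞) (μ := μ) (1 : ℂ)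
  map_nonneg := hP.map_nonneg

/-- `P†` on bounded functions. -/
noncomputable def daggerTop (μ : Measure Ω) [IsProbabilityMeasure μ]
    (P : Lp ℂ ∞ μ →ₗ[ℂ] Lp ℂ ∞ μ) : Lp ℂ ∞ μ →ₗ[ℂ] Lp ℂ 2 μ :=
  (dagger μ P).toLinearMap ∘ₗ inclTwo μ

theorem inclTwo_toLpClass {f : Ω → ℂ} (hf : MemLp f ∞ μ) :
    inclTwo μ (toLpClass ∞ μ f) = toLpClass 2 μ f := by
  ext1
  exact (inclTwo_coeFn μ _).trans ((toLpClass_coeFn hf).trans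
    (toLpClass_coeFn (hf.mono_exponent le_top)).symm)

theorem matDagger_eq_mapEntries {n : ℕ} {F : Ω → Matrix (Fin n) (Fin n) ℂ}
    (hF : ∀ i j, MemLp (fun x => F x i j) ∞ μ) (x : Ω) :
    matDagger μ P F x = mapEntries (daggerTop μ P) F x := by
  ext i j
  simp only [matDagger, mapEntries, Matrix.of_apply, daggerTop, LinearMap.comp_apply,
    inclTwo_toLpClass (hF i j)]
  rfl

theorem IsMarkovPreserving.integral_daggerTop (hP : IsMarkovPreserving μ P) (h f : Lp ℂ ∞ μ) :
    ∫ x, star (daggerTop μ P h x) * f x ∂μ = ∫ x, star (h x) * P f x ∂μ := by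
  have := hP.inner_dagger (inclTwo μ h) f
  rw [L2.inner_def, L2.inner_def] at this
  calc ∫ x, star (daggerTop μ P h x) * f x ∂μ
      = ∫ x, inner ℂ (dagger μ P (inclTwo μ h) x) (inclTwo μ f x) ∂μ := by
        refine integral_congr_ae ?_
        filter_upwards [inclTwo_coeFn μ f] with x hx
        rw [hx, RCLike.inner_apply, mul_comm]
        rfl
    _ = _ := this
    _ = _ := by
        refine integral_congr_ae ?_
        filter_upwards [inclTwo_coeFn μ h, inclTwo_coeFn μ (P f)] with x hx hx'
        rw [hx, hx', RCLike.inner_apply, mul_comm]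
        rfl

theorem integrable_daggerTop (f : Lp ℂ ∞ μ) : Integrable (daggerTop μ P f) μ :=
  ((Lp.memLp _).mono_exponent (p := 1) one_le_two).integrable le_rfl

theorem setIntegral_eq_integral_mul_indicator {f : Ω → ℂ} {s : Set Ω} (hs : MeasurableSet s) :
    ∫ x in s, f x ∂μ = ∫ x, f x * toLpClass ∞ μ (s.indicator fun _ => 1) x ∂μ := by
  rw [← integral_indicator hs]
  refine integral_congr_ae ?_
  have hm : MemLp (s.indicator fun _ : Ω => (1 : ℂ)) ∞ μ := (memLp_const _).indicator hs
  filter_upwards [toLpClass_coeFn hm] with x hx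
  rw [hx]
  by_cases h : x ∈ s <;> simp [h]

/-- Test against indicators: `∫_s conj (P† h) = ∫ conj h · P 1_s`. Positivity of `P` makes this
nonnegative for `h ≥ 0`, and for `h = 1` invariance of `μ` makes it `μ(s)`. The conjugate comes from
the first slot of the inner product and is removed at the end. -/
theorem IsMarkovPreserving.daggerTop_isPositiveUnital (hP : IsMarkovPreserving μ P) :
    IsPositiveUnital (daggerTop μ P) where
  map_nonneg h hh := by
    have hint : Integrable (fun x => star (daggerTop μ P h x)) μ :=
      Complex.conjLIE.integrable_comp_iff.2 (integrable_daggerTop h)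
    have : ∀ᵐ x ∂μ, 0 ≤ star (daggerTop μ P h x) := by
      refine ae_nonneg_of_forall_setIntegral hint fun s hs => ?_
      rw [setIntegral_eq_integral_mul_indicator hs, hP.integral_daggerTop]
      have hm : MemLp (s.indicator fun _ : Ω => (1 : ℂ)) ∞ μ := (memLp_const _).indicator hs
      have hpos := hP.isPositiveUnital.nonneg hm (.of_forall fun x => by
        by_cases h : x ∈ s <;> simp [h])
      refine integral_nonneg_of_ae ?_
      filter_upwards [hh, hpos] with x h1 h2
      exact mul_nonneg (star_nonneg_iff.2 h1) h2
    filter_upwards [this] with x hx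
    exact star_nonneg_iff.1 hx
  map_one := by
    have hint : Integrable (fun x => star (daggerTop μ P (Lp.const ∞ μ (1 : ℂ)) x)) μ :=
      Complex.conjLIE.integrable_comp_iff.2 (integrable_daggerTop _)
    have : (fun x => star (daggerTop μ P (Lp.const ∞ μ (1 : ℂ)) x)) =ᵐ[μ] fun _ => 1 := by
      refine Integrable.ae_eq_of_forall_setIntegral_eq _ _ hint (integrable_const _)
        fun s hs _ => ?_
      rw [setIntegral_eq_integral_mul_indicator hs, hP.integral_daggerTop,
        setIntegral_eq_integral_mul_indicator (f := fun _ => 1) hs]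
      simp only [one_mul]
      rw [← hP.integral_map]
      refine integral_congr_ae ?_
      filter_upwards [Lp.coeFn_const (p := ∞) (μ := μ) (1 : ℂ)] with x hx
      rw [hx]; simp
    filter_upwards [this] with x hx
    rw [← star_star (daggerTop μ P _ x), hx, star_one]

/-- `∫ tr(Mᵀ P G) = ∫ tr((P† M)ᵀ G)` for Hermitian `M`. -/
theorem IsMarkovPreserving.integral_sum_mul (hP : IsMarkovPreserving μ P) {ι : Type*} [Fintype ι]
    {M G : Ω → Matrix ι ι ℂ} (hM : IsBoundedPosSemidef μ M)
    (hG : ∀ i j, MemLp (fun x => G x i j) ∞ μ) :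
    ∫ x, ∑ i, ∑ j, M x i j * mapEntries P G x i j ∂μ =
      ∫ x, ∑ i, ∑ j, mapEntries (daggerTop μ P) M x i j * G x i j ∂μ := by
  have hT := hP.daggerTop_isPositiveUnital
  have hMQ := hM.mapEntries hT
  have hPG : ∀ i j, MemLp (fun x => mapEntries P G x i j) ∞ μ := fun i j => Lp.memLp _
  have hi1 : ∀ i j, Integrable (fun x => M x i j * mapEntries P G x i j) μ := fun i j =>
    ((MemLp.mul (p := ∞) (q := ∞) (r := ∞) (hPG i j) (hM.memLp i j)).mono_exponent
      (p := 1) le_top).integrable le_rfl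
  have hi2 : ∀ i j, Integrable (fun x => mapEntries (daggerTop μ P) M x i j * G x i j) μ :=
    fun i j => ((MemLp.mul (p := ∞) (q := ∞) (r := ∞) (hG i j) (hMQ.memLp i j)).mono_exponent
      (p := 1) le_top).integrable le_rfl
  rw [integral_finsetSum _ fun i _ => integrable_finsetSum _ fun j _ => hi1 i j,
    integral_finsetSum _ fun i _ => integrable_finsetSum _ fun j _ => hi2 i j]
  refine Finset.sum_congr rfl fun i _ => ?_
  rw [integral_finsetSum _ fun j _ => hi1 i j, integral_finsetSum _ fun j _ => hi2 i j]
  refine Finset.sum_congr rfl fun j _ => ?_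
  -- The transposed entry `M j i` is used because the pairing conjugates its first argument;
  -- Hermitian symmetry turns it back into `M i j`, before and after `P†`.
  have := hP.integral_daggerTop (toLpClass ∞ μ fun x => M x j i) (toLpClass ∞ μ fun x => G x i j)
  calc ∫ x, M x i j * mapEntries P G x i j ∂μ
      = ∫ x, star (toLpClass ∞ μ (fun x => M x j i) x) *
          P (toLpClass ∞ μ fun x => G x i j) x ∂μ := by
        refine integral_congr_ae ?_
        filter_upwards [hM.posSemidef, toLpClass_coeFn (hM.memLp j i)] with x h1 h2
        rw [h2, h1.1.apply i j]
        rfl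
    _ = _ := this.symm
    _ = _ := by
        refine integral_congr_ae ?_
        filter_upwards [hMQ.posSemidef, toLpClass_coeFn (hG i j)] with x h1 h2
        rw [h2, ← h1.1.apply i j]
        rfl

end Dagger

/-! ## Measures with a smooth density -/

section BilinearBundle

variable {B : Type*} [TopologicalSpace B] {F : Type*} [NormedAddCommGroup F] [NormedSpace ℝ F]
  {E : B → Type*} [TopologicalSpace (Bundle.TotalSpace F E)] [∀ x, AddCommGroup (E x)]
  [∀ x, Module ℝ (E x)] [∀ x, TopologicalSpace (E x)] [FiberBundle F E] [VectorBundle ℝ F E]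

/-- A continuous family of bilinear forms is continuous along continuous sections. -/
theorem Continuous.continuousOn_bilinear {g : ∀ x, E x →L[ℝ] E x →L[ℝ] ℝ}
    (hg : Continuous fun x => Bundle.TotalSpace.mk' (F →L[ℝ] F →L[ℝ] ℝ) x (g x))
    {X : Type*} [TopologicalSpace X] {b : X → B} {v w : ∀ x, E (b x)} {s : Set X}
    (hv : ContinuousOn (fun m => (⟨b m, v m⟩ : Bundle.TotalSpace F E)) s)
    (hw : ContinuousOn (fun m => (⟨b m, w m⟩ : Bundle.TotalSpace F E)) s) :
    ContinuousOn (fun m => g (b m) (v m) (w m)) s := by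
  intro x hx
  have hb : ContinuousWithinAt b s x :=
    ((FiberBundle.continuousWithinAt_totalSpace F _).1 (hv x hx)).1
  have : ContinuousWithinAt (fun m => Bundle.TotalSpace.mk' ℝ (E := Bundle.Trivial B ℝ) (b m)
      (g (b m) (v m) (w m))) s x :=
    (hg.continuousAt.comp_continuousWithinAt hb).clm_bundle_apply₂ (F₁ := F) (F₂ := F)
      (hv x hx) (hw x hx)
  simp only [FiberBundle.continuousWithinAt_totalSpace] at this
  exact this.2

end BilinearBundle

section SmoothDensity

variable {d : ℕ} {M : Type*} [TopologicalSpace M]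
    [ChartedSpace (EuclideanSpace ℝ (Fin d)) M]
    [IsManifold 𝓘(ℝ, EuclideanSpace ℝ (Fin d)) ∞ M]
    (g : Bundle.ContMDiffRiemannianMetric 𝓘(ℝ, EuclideanSpace ℝ (Fin d)) ∞
      (EuclideanSpace ℝ (Fin d))
      (fun x : M => TangentSpace 𝓘(ℝ, EuclideanSpace ℝ (Fin d)) x))

theorem continuousOn_mfderiv_chart_symm (x₀ : M) (v : EuclideanSpace ℝ (Fin d)) :
    ContinuousOn (fun y => (⟨(chartAt (EuclideanSpace ℝ (Fin d)) x₀).symm y,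
      mfderiv 𝓘(ℝ, EuclideanSpace ℝ (Fin d)) 𝓘(ℝ, EuclideanSpace ℝ (Fin d))
        (chartAt (EuclideanSpace ℝ (Fin d)) x₀).symm y v⟩ :
      TangentBundle 𝓘(ℝ, EuclideanSpace ℝ (Fin d)) M))
      (chartAt (EuclideanSpace ℝ (Fin d)) x₀).target := by
  set e := chartAt (EuclideanSpace ℝ (Fin d)) x₀
  have h1 : ContMDiffOn 𝓘(ℝ, EuclideanSpace ℝ (Fin d)) 𝓘(ℝ, EuclideanSpace ℝ (Fin d)) ∞
    e.symm e.target := contMDiffOn_chart_symm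
  have h2 := h1.continuousOn_tangentMapWithin (by simp) e.open_target.uniqueMDiffOn
  have h3 : Continuous (fun y : EuclideanSpace ℝ (Fin d) =>
      (⟨y, v⟩ : TangentBundle 𝓘(ℝ, EuclideanSpace ℝ (Fin d)) (EuclideanSpace ℝ (Fin d)))) :=
    (contMDiff_vectorSpace_iff_contDiff (n := ∞) (V := fun _ => v)).2 contDiff_const |>.continuous
  have h4 := h2.comp h3.continuousOn (s := e.target) (fun y hy => hy)
  refine h4.congr fun y hy => ?_
  simp only [Function.comp_apply, tangentMapWithin, mfderivWithin_of_isOpen e.open_target hy]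

theorem continuousOn_chartGram (x₀ : M) :
    ContinuousOn (fun y => chartGram g (chartAt (EuclideanSpace ℝ (Fin d)) x₀) y)
      (chartAt (EuclideanSpace ℝ (Fin d)) x₀).target := by
  refine continuousOn_pi.2 fun i => continuousOn_pi.2 fun j => ?_
  exact g.contMDiff.continuous.continuousOn_bilinear
    (continuousOn_mfderiv_chart_symm x₀ (EuclideanSpace.single i 1))
    (continuousOn_mfderiv_chart_symm x₀ (EuclideanSpace.single j 1))

/-- The metric is positive definite and the derivative of the inverse chart is injective, so the
coordinate vector fields are linearly independent. Hence the volume density `√det` never vanishes.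
-/
theorem chartGram_posDef (x₀ : M) {y : EuclideanSpace ℝ (Fin d)}
    (hy : y ∈ (chartAt (EuclideanSpace ℝ (Fin d)) x₀).target) :
    (chartGram g (chartAt (EuclideanSpace ℝ (Fin d)) x₀) y).PosDef := by
  set e := chartAt (EuclideanSpace ℝ (Fin d)) x₀
  let D : EuclideanSpace ℝ (Fin d) →L[ℝ] EuclideanSpace ℝ (Fin d) :=
    mfderiv 𝓘(ℝ, EuclideanSpace ℝ (Fin d)) 𝓘(ℝ, EuclideanSpace ℝ (Fin d)) e.symm y
  let G : EuclideanSpace ℝ (Fin d) →L[ℝ] EuclideanSpace ℝ (Fin d) →L[ℝ] ℝ := g.inner (e.symm y)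
  have hGram : ∀ i j, chartGram g e y i j =
    G (D (EuclideanSpace.single i 1)) (D (EuclideanSpace.single j 1)) := fun i j => rfl
  have hinj : Function.Injective D :=
    (mdifferentiable_chart x₀).symm.mfderiv_injective hy
  refine .of_dotProduct_mulVec_pos ?_ fun c hc => ?_
  · ext i j
    exact g.symm _ _ _
  · set w : EuclideanSpace ℝ (Fin d) := WithLp.toLp 2 c with hw
    have hw0 : D w ≠ 0 := by
      intro h0
      have : w = 0 := hinj (h0.trans (map_zero D).symm)
      exact hc (by simpa [hw] using this)
    have hsum : w = ∑ i, c i • EuclideanSpace.single i (1 : ℝ) := by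
      ext j; simp [hw, Pi.single_apply]
    have hpos : 0 < G (D w) (D w) := g.pos _ _ hw0
    have : star c ⬝ᵥ (chartGram g e y).mulVec c = G (D w) (D w) := by
      rw [hsum]
      simp only [map_sum, map_smul, sum_apply, smul_apply, smul_eq_mul, dotProduct,
        Matrix.mulVec, hGram, Finset.mul_sum, Pi.star_apply, star_trivial]
      rw [Finset.sum_comm]
      exact Finset.sum_congr rfl fun i _ => Finset.sum_congr rfl fun j _ => by ring
    rw [this]
    exact hpos

variable {g} [SecondCountableTopology M] [MeasurableSpace M] [BorelSpace M]
  {μ : Measure M}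

/-- Continuous functions that agree almost everywhere are locally equal almost everywhere. -/
theorem HasSmoothDensity.ae_eventuallyEq (hμ : HasSmoothDensity g μ) {Y : Type*}
    [TopologicalSpace Y] [T2Space Y] {u v : M → Y} (hu : Continuous u) (hv : Continuous v)
    (huv : u =ᵐ[μ] v) : ∀ᵐ x ∂μ, u =ᶠ[nhds x] v := by
  obtain ⟨ρ, hρ, hρ0, hdens⟩ := hμ
  have hρc : Continuous ρ := hρ.continuous
  -- The zero set of `ρ` is null: by second countability this is local, and in a chart the density
  -- vanishes on it.
  have hZ : μ {x | ρ x = 0} = 0 := by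
    refine measure_null_of_locally_null _ fun x₀ _ => ?_
    set e := chartAt (EuclideanSpace ℝ (Fin d)) x₀
    have hsrc : e.source ∈ nhds x₀ := e.open_source.mem_nhds (mem_chart_source _ x₀)
    refine ⟨{x | ρ x = 0} ∩ e.source,
      Filter.inter_mem self_mem_nhdsWithin (mem_nhdsWithin_of_mem_nhds hsrc), ?_⟩
    have hZm : MeasurableSet {x | ρ x = 0} := (isClosed_eq hρc continuous_const).measurableSet
    rw [hdens x₀ _ (hZm.inter e.open_source.measurableSet) Set.inter_subset_right]
    have himg : e '' ({x | ρ x = 0} ∩ e.source)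
        = e.target \ (e.target ∩ e.symm ⁻¹' {x | ρ x ≠ 0}) := by
      ext y
      constructor
      · rintro ⟨x, ⟨hx, hxs⟩, rfl⟩
        refine ⟨e.map_source hxs, fun h => h.2 ?_⟩
        simpa [e.left_inv hxs] using hx
      · rintro ⟨hy, hy'⟩
        refine ⟨e.symm y, ⟨?_, e.map_target hy⟩, e.right_inv hy⟩
        by_contra h
        exact hy' ⟨hy, h⟩
    have hmeas : MeasurableSet (e '' ({x | ρ x = 0} ∩ e.source)) := by
      rw [himg]
      exact e.open_target.measurableSet.diff (e.symm.isOpen_inter_preimage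
        (isOpen_ne_fun hρc continuous_const)).measurableSet
    rw [setLIntegral_congr_fun (g := fun _ => 0) hmeas]
    · simp
    · rintro y ⟨x, ⟨hx, hxs⟩, rfl⟩
      have : ρ (e.symm (e x)) = 0 := by rw [e.left_inv hxs]; exact hx
      change ENNReal.ofReal (ρ (e.symm (e x)) * _) = 0
      simp [this]
  -- Conversely, an open null set cannot meet `{ρ ≠ 0}`: the intersection would contain a nonempty
  -- open chart piece with strictly positive density.
  have hU : ∀ U : Set M, IsOpen U → μ U = 0 → ∀ x ∈ U, ρ x = 0 := by
    intro U hUo hU0 x₀ hx₀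
    by_contra hne
    set e := chartAt (EuclideanSpace ℝ (Fin d)) x₀
    set V := U ∩ {x | ρ x ≠ 0} ∩ e.source
    have hVo : IsOpen V := (hUo.inter (isOpen_ne_fun hρc continuous_const)).inter e.open_source
    have hVx : x₀ ∈ V := ⟨⟨hx₀, hne⟩, mem_chart_source _ x₀⟩
    have hVs : V ⊆ e.source := Set.inter_subset_right
    have hV0 : μ V = 0 := measure_mono_null (fun x hx => hx.1.1) hU0
    rw [hdens x₀ V hVo.measurableSet hVs] at hV0
    have himg : IsOpen (e '' V) := e.isOpen_image_of_subset_source hVo hVs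
    have hsub : e '' V ⊆ e.target := by
      rintro _ ⟨x, hx, rfl⟩; exact e.map_source (hVs hx)
    have hcont : ContinuousOn (fun y => ENNReal.ofReal (ρ (e.symm y) *
        Real.sqrt (chartGram g e y).det)) (e '' V) := by
      refine ENNReal.continuous_ofReal.comp_continuousOn (ContinuousOn.mul ?_ ?_)
      · exact hρc.comp_continuousOn (e.continuousOn_symm.mono hsub)
      · refine Real.continuous_sqrt.comp_continuousOn ?_
        exact (continuous_id.matrix_det).comp_continuousOn
          ((continuousOn_chartGram g x₀).mono hsub)
    rw [lintegral_eq_zero_iff' (hcont.aemeasurable himg.measurableSet)] at hV0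
    have hfalse : ∀ᵐ y ∂(volume.restrict (e '' V)), False := by
      filter_upwards [hV0, ae_restrict_mem himg.measurableSet] with y hy hyV
      have h1 : 0 < (chartGram g e y).det := (chartGram_posDef g x₀ (hsub hyV)).det_pos
      obtain ⟨x, hx, rfl⟩ := hyV
      have h2 : 0 < ρ (e.symm (e x)) := by
        rw [e.left_inv (hVs hx)]; exact (hρ0 x).lt_of_ne' hx.1.2
      simp only [Pi.zero_apply, ENNReal.ofReal_eq_zero] at hy
      exact absurd hy (not_le.2 (mul_pos h2 (Real.sqrt_pos.2 h1)))
    have : (volume.restrict (e '' V)) Set.univ = 0 := by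
      simpa [ae_iff] using hfalse
    rw [Measure.restrict_apply_univ] at this
    exact (himg.measure_pos volume ⟨e x₀, x₀, hVx, rfl⟩).ne' this
  have hne : IsOpen {x | u x ≠ v x} := isOpen_ne_fun hu hv
  have hpos : ∀ᵐ x ∂μ, ρ x ≠ 0 := by rw [ae_iff]; simpa using hZ
  -- The set where `u` and `v` differ is open and null, so it lies in `{ρ = 0}`. Almost every point
  -- has `ρ ≠ 0`, and then a whole neighbourhood avoids that set.
  filter_upwards [hpos] with x hx
  have hopen : IsOpen {x | ρ x ≠ 0} := isOpen_ne_fun hρc continuous_const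
  filter_upwards [hopen.mem_nhds hx] with y hy
  by_contra h
  exact hy (hU _ hne huv y h)

end SmoothDensity

/-! ## Derivatives along vector fields -/

section LieDeriv

variable {d : ℕ} {M : Type*} [TopologicalSpace M] [ChartedSpace (EuclideanSpace ℝ (Fin d)) M]

theorem ContMDiff.const_mul_complex {n : WithTop ℕ∞} {u : M → ℂ}
    (hu : ContMDiff 𝓘(ℝ, EuclideanSpace ℝ (Fin d)) 𝓘(ℝ, ℂ) n u) (c : ℂ) :
    ContMDiff 𝓘(ℝ, EuclideanSpace ℝ (Fin d)) 𝓘(ℝ, ℂ) n (fun x => c * u x) :=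
  (ContinuousLinearMap.mul ℝ ℂ c).contDiff.comp_contMDiff hu

theorem ContMDiff.sum_mul_complex {n : WithTop ℕ∞} {κ : Type*} (s : Finset κ) (c : κ → ℂ)
    {u : κ → M → ℂ} (hu : ∀ k, ContMDiff 𝓘(ℝ, EuclideanSpace ℝ (Fin d)) 𝓘(ℝ, ℂ) n (u k)) :
    ContMDiff 𝓘(ℝ, EuclideanSpace ℝ (Fin d)) 𝓘(ℝ, ℂ) n (fun x => ∑ k ∈ s, c k * u k x) :=
  contMDiff_finsetSum fun k _ => (hu k).const_mul_complex (c k)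

theorem IsTestFunction.sum_mul {κ : Type*} (s : Finset κ) (c : κ → ℂ) {u : κ → M → ℂ}
    (hu : ∀ k, IsTestFunction (d := d) (u k)) :
    IsTestFunction (d := d) (fun x => ∑ k ∈ s, c k * u k x) := by
  refine ⟨ContMDiff.sum_mul_complex s c fun k => (hu k).smooth, ?_⟩
  classical
  induction s using Finset.induction_on with
  | empty => simp only [Finset.sum_empty]; exact HasCompactSupport.zero
  | insert a s ha ih =>
    simp only [Finset.sum_insert ha]
    exact HasCompactSupport.add (HasCompactSupport.mul_left (hu a).compactSupport) ih

variable (X : ∀ x : M, TangentSpace 𝓘(ℝ, EuclideanSpace ℝ (Fin d)) x)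

theorem lieDeriv_sum_mul {κ : Type} (s : Finset κ) (c : κ → ℂ) {u : κ → M → ℂ} {x : M}
    (hu : ∀ k, MDifferentiableAt 𝓘(ℝ, EuclideanSpace ℝ (Fin d)) 𝓘(ℝ, ℂ) (u k) x) :
    lieDeriv X (fun y => ∑ k ∈ s, c k * u k y) x = ∑ k ∈ s, c k * lieDeriv X (u k) x := by
  have h1 : ∀ k, HasMFDerivAt 𝓘(ℝ, EuclideanSpace ℝ (Fin d)) 𝓘(ℝ, ℂ) (fun y => c k * u k y) x
      ((ContinuousLinearMap.mul ℝ ℂ (c k)).comp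
        (mfderiv 𝓘(ℝ, EuclideanSpace ℝ (Fin d)) 𝓘(ℝ, ℂ) (u k) x)) := fun k =>
    HasMFDerivAt.comp x (ContinuousLinearMap.mul ℝ ℂ (c k)).hasMFDerivAt (hu k).hasMFDerivAt
  let D : κ → EuclideanSpace ℝ (Fin d) →L[ℝ] ℂ := fun k => (ContinuousLinearMap.mul ℝ ℂ (c k)).comp
    (mfderiv 𝓘(ℝ, EuclideanSpace ℝ (Fin d)) 𝓘(ℝ, ℂ) (u k) x)
  have h2 : HasMFDerivAt 𝓘(ℝ, EuclideanSpace ℝ (Fin d)) 𝓘(ℝ, ℂ)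
      (∑ k ∈ s, fun y => c k * u k y) x (∑ k ∈ s, D k) :=
    HasMFDerivAt.sum (f := fun k y => c k * u k y) (f' := D) fun k _ => h1 k
  have h3 : (∑ k ∈ s, fun y => c k * u k y) = fun y => ∑ k ∈ s, c k * u k y := by
    ext y; simp
  rw [h3] at h2
  unfold lieDeriv
  rw [h2.mfderiv]
  exact sum_apply _ _ _

theorem lieDeriv_congr {u v : M → ℂ} {x : M} (h : u =ᶠ[nhds x] v) :
    lieDeriv X u x = lieDeriv X v x := by
  unfold lieDeriv
  rw [h.mfderiv_eq]
  rfl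

variable [IsManifold 𝓘(ℝ, EuclideanSpace ℝ (Fin d)) ∞ M] {X}

theorem continuous_lieDeriv (hX : IsSmoothVectorField X) {u : M → ℂ}
    (hu : ContMDiff 𝓘(ℝ, EuclideanSpace ℝ (Fin d)) 𝓘(ℝ, ℂ) 1 u) :
    Continuous (lieDeriv X u) := by
  have : IsManifold 𝓘(ℝ, EuclideanSpace ℝ (Fin d)) 1 M := .of_le (n := ∞) (by simp)
  exact (contMDiff_snd_tangentBundle_modelSpace (n := 0) ℂ 𝓘(ℝ, ℂ)).continuous.comp
    ((hu.continuous_tangentMap le_rfl).comp hX.continuous)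

end LieDeriv

/-! ### Gram matrices of horizontal gradients and the trace pairing -/

section GradForm

variable {d : ℕ} {M : Type*} [TopologicalSpace M] [ChartedSpace (EuclideanSpace ℝ (Fin d)) M]
  {k : ℕ} (X : Fin k → ∀ x : M, TangentSpace 𝓘(ℝ, EuclideanSpace ℝ (Fin d)) x)

/-- The matrix `[Γ(u_i, u_j)]`. -/
noncomputable def gradMatrix {ι : Type*} (u : ι → M → ℂ) (x : M) : Matrix ι ι ℂ :=
  Matrix.of fun i j => gradForm X (u i) (u j) x

variable {ι : Type*} [Fintype ι]

theorem gradForm_of_lieDeriv_eq_sum {u : M → ℂ} {w : ι → M → ℂ} {c : ι → ℂ} {x : M}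
    (h : ∀ m, lieDeriv (X m) u x = ∑ i, c i * lieDeriv (X m) (w i) x) :
    gradForm X u u x = ∑ i, ∑ j, star (c i) * c j * gradMatrix X w x i j := by
  simp only [gradForm, gradMatrix, Matrix.of_apply, h, star_sum, star_mul', Finset.sum_mul_sum]
  rw [Finset.sum_comm]
  refine Finset.sum_congr rfl fun i _ => ?_
  rw [Finset.sum_comm]
  refine Finset.sum_congr rfl fun j _ => ?_
  rw [Finset.mul_sum]
  exact Finset.sum_congr rfl fun m _ => by ring

theorem gradMatrix_posSemidef (u : ι → M → ℂ) (x : M) : (gradMatrix X u x).PosSemidef := by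
  have h : gradMatrix X u x = ∑ m, Matrix.vecMulVec (star fun i => lieDeriv (X m) (u i) x)
      (fun i => lieDeriv (X m) (u i) x) := by
    ext i j
    simp [gradMatrix, gradForm, Matrix.sum_apply, Matrix.vecMulVec_apply]
  rw [h]
  exact Matrix.posSemidef_sum _ fun m _ => Matrix.posSemidef_vecMulVec_star_self _

/-- Expanding the trace over pairs (row, column) separates the weights from the derivatives: both
factors are positive semidefinite matrices on `Fin n × Fin n`, so Loewner inequalities for either
one can be inserted. -/
theorem gradPairing_eq_sum {n : ℕ} (u : M → Matrix (Fin n) (Fin n) ℂ)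
    (A B : M → Matrix (Fin n) (Fin n) ℂ) (s t : ℝ) (x : M) :
    gradPairing X u (fun y => matPow (A y) s) (fun y => matPow (B y) t) x =
      ∑ p, ∑ q, powKron (A x) (B x) s t p q *
        gradMatrix X (fun (p : Fin n × Fin n) y => u y p.1 p.2) x p q := by
  have h : ∀ Q D R : Matrix (Fin n) (Fin n) ℂ, (D.conjTranspose * (Q * D * R)).trace =
      ∑ p : Fin n × Fin n, ∑ q : Fin n × Fin n,
        Q p.1 q.1 * R q.2 p.2 * (star (D p.1 p.2) * D q.1 q.2) := by
    intro Q D R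
    simp only [Matrix.trace, Matrix.diag, Matrix.mul_apply, Matrix.conjTranspose_apply,
      Fintype.sum_prod_type, Finset.mul_sum, Finset.sum_mul]
    rw [Finset.sum_comm]
    refine Finset.sum_congr rfl fun i _ => Finset.sum_congr rfl fun l _ => ?_
    rw [Finset.sum_comm]
    exact Finset.sum_congr rfl fun j _ => Finset.sum_congr rfl fun k _ => by ring
  simp only [gradPairing, h, gradMatrix, gradForm, Matrix.of_apply, powKron_apply, Finset.mul_sum,
    matLieDeriv]
  rw [Finset.sum_comm]
  exact Finset.sum_congr rfl fun p _ => Finset.sum_comm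

end GradForm

/-! ## Gradient estimates -/

section GradientEstimate

variable {d : ℕ} {M : Type*} [TopologicalSpace M] [ChartedSpace (EuclideanSpace ℝ (Fin d)) M]
  [MeasurableSpace M] {μ : Measure M} {P : Lp ℂ ∞ μ →ₗ[ℂ] Lp ℂ ∞ μ}

theorem applyP_contMDiff {f : M → ℂ} (h : HasC1Version (d := d) μ (P (toLpClass ∞ μ f))) :
    ContMDiff 𝓘(ℝ, EuclideanSpace ℝ (Fin d)) 𝓘(ℝ, ℂ) 1 (applyP (d := d) μ P f) := by
  rw [applyP, c1Version, dif_pos h]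
  exact h.choose_spec.1

theorem applyP_ae_eq {f : M → ℂ} (h : HasC1Version (d := d) μ (P (toLpClass ∞ μ f))) :
    applyP (d := d) μ P f =ᵐ[μ] P (toLpClass ∞ μ f) := by
  rw [applyP, c1Version, dif_pos h]
  exact h.choose_spec.2

variable [IsManifold 𝓘(ℝ, EuclideanSpace ℝ (Fin d)) ∞ M]
  [BorelSpace M]
  {g : Bundle.ContMDiffRiemannianMetric 𝓘(ℝ, EuclideanSpace ℝ (Fin d)) ∞
      (EuclideanSpace ℝ (Fin d))
      (fun x : M => TangentSpace 𝓘(ℝ, EuclideanSpace ℝ (Fin d)) x)}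
  {k : ℕ} {X : Fin k → ∀ x : M, TangentSpace 𝓘(ℝ, EuclideanSpace ℝ (Fin d)) x}
  [IsProbabilityMeasure μ]
  {ι : Type} [Fintype ι]

/-- The representative chosen for the combination and the combination of the chosen representatives
are continuous and equal almost everywhere, so they coincide near almost every point, where their
derivatives agree. -/
theorem lieDeriv_applyP_sum_ae [SecondCountableTopology M] (hμ : HasSmoothDensity g μ)
    (hreg : ∀ f : M → ℂ, IsTestFunction (d := d) f →
      HasC1Version (d := d) μ (P (toLpClass ∞ μ f)))
    {f : ι → M → ℂ} (hf : ∀ i, IsTestFunction (d := d) (f i)) (c : ι → ℂ) :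
    ∀ᵐ x ∂μ, ∀ m, lieDeriv (X m) (applyP (d := d) μ P fun y => ∑ i, c i * f i y) x =
      ∑ i, c i * lieDeriv (X m) (applyP (d := d) μ P (f i)) x := by
  have h1 := hreg _ (IsTestFunction.sum_mul Finset.univ c hf)
  have h2 := fun i => hreg _ (hf i)
  have hsum : ContMDiff 𝓘(ℝ, EuclideanSpace ℝ (Fin d)) 𝓘(ℝ, ℂ) 1
      (fun x => ∑ i, c i * applyP (d := d) μ P (f i) x) :=
    ContMDiff.sum_mul_complex _ c fun i => applyP_contMDiff (h2 i)
  have hae : applyP (d := d) μ P (fun y => ∑ i, c i * f i y) =ᵐ[μ]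
      fun x => ∑ i, c i * applyP (d := d) μ P (f i) x := by
    filter_upwards [applyP_ae_eq h1, P.toLpClass_sum_ae Finset.univ c
      (fun i => (hf i).memLp μ ∞), ae_all_iff.2 fun i => applyP_ae_eq (h2 i)] with x e1 e2 e3
    rw [e1, e2]
    exact Finset.sum_congr rfl fun i _ => by rw [e3 i]
  filter_upwards [hμ.ae_eventuallyEq (applyP_contMDiff h1).continuous hsum.continuous hae]
    with x hx m
  rw [lieDeriv_congr (X m) hx]
  exact lieDeriv_sum_mul (X m) _ c fun i => (applyP_contMDiff (h2 i)).mdifferentiable one_ne_zero x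

variable [T2Space M]

theorem gradMatrix_isBoundedPosSemidef (hX : ∀ m, IsSmoothVectorField (X m)) {f : ι → M → ℂ}
    (hf : ∀ i, IsTestFunction (d := d) (f i)) : IsBoundedPosSemidef μ (gradMatrix X f) :=
  ⟨fun i j => (hf i).gradForm_memLp hX (hf j) μ, .of_forall fun x => gradMatrix_posSemidef X f x⟩

/-- The gradient estimate for scalar functions implies the matrix gradient estimate. -/
theorem gradMatrix_applyP_le [SecondCountableTopology M] (hμ : HasSmoothDensity g μ)
    (hX : ∀ m, IsSmoothVectorField (X m))
    (hreg : ∀ f : M → ℂ, IsTestFunction (d := d) f →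
      HasC1Version (d := d) μ (P (toLpClass ∞ μ f)))
    {C : ℝ} (hgrad : ∀ f : M → ℂ, IsTestFunction (d := d) f →
      ∀ᵐ x ∂μ, gradForm X (applyP (d := d) μ P f) (applyP (d := d) μ P f) x ≤
        (C : ℂ) * P (toLpClass ∞ μ (gradForm X f f)) x)
    {f : ι → M → ℂ} (hf : ∀ i, IsTestFunction (d := d) (f i)) :
    ∀ᵐ x ∂μ, gradMatrix X (fun i => applyP (d := d) μ P (f i)) x ≤
      (C : ℂ) • mapEntries P (gradMatrix X f) x := by
  have key : ∀ c : ι → ℂ, ∀ᵐ x ∂μ, 0 ≤ star c ⬝ᵥ ((C : ℂ) • mapEntries P (gradMatrix X f) x -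
      gradMatrix X (fun i => applyP (d := d) μ P (f i)) x).mulVec c := by
    intro c
    have hG : gradForm X (fun y => ∑ i, c i * f i y) (fun y => ∑ i, c i * f i y) =
        fun x => ∑ i, ∑ j, star (c i) * c j * gradMatrix X f x i j := by
      ext x
      exact gradForm_of_lieDeriv_eq_sum X fun m => lieDeriv_sum_mul (X m) _ c fun i =>
        (hf i).smooth.mdifferentiable (by simp) x
    filter_upwards [hgrad _ (IsTestFunction.sum_mul Finset.univ c hf),
      lieDeriv_applyP_sum_ae (X := X) hμ hreg hf c,
      mapEntries_sum_sum P (gradMatrix_isBoundedPosSemidef (μ := μ) hX hf).memLp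
        fun i j => star (c i) * c j] with x h1 h2 h3
    rw [gradForm_of_lieDeriv_eq_sum X h2, hG, h3] at h1
    rw [Matrix.sub_mulVec, dotProduct_sub, Matrix.smul_mulVec, dotProduct_smul,
      Matrix.dotProduct_mulVec_eq_sum, Matrix.dotProduct_mulVec_eq_sum, smul_eq_mul]
    exact sub_nonneg.2 h1
  filter_upwards [ae_all_iff.2 fun i : ℕ =>
    key (TopologicalSpace.denseSeq (ι → ℂ) i)] with x hx
  exact Matrix.le_iff.2 (.of_forall_denseSeq hx)

end GradientEstimate

/-! ### The integrated inequality for the kernels -/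

section Pairing

variable {Ω : Type*} [MeasurableSpace Ω] {μ : Measure Ω} {ι : Type*} [Fintype ι]

/-- The derivatives of `P f` are only known to be continuous, not bounded; boundedness of their Gram
matrix is extracted from the gradient estimate itself. -/
theorem IsBoundedPosSemidef.of_le {F G : Ω → Matrix ι ι ℂ} (hG : IsBoundedPosSemidef μ G)
    (hF : ∀ i j, AEStronglyMeasurable (fun x => F x i j) μ) (hpos : ∀ᵐ x ∂μ, (F x).PosSemidef)
    {C : ℝ} (h : ∀ᵐ x ∂μ, F x ≤ (C : ℂ) • G x) : IsBoundedPosSemidef μ F := by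
  obtain ⟨R, hR⟩ := hG.exists_trace_le
  refine ⟨fun i j => memLp_top_of_bound (hF i j) (|C| * R) ?_, hpos⟩
  filter_upwards [hpos, h, hR, hG.posSemidef] with x h1 h2 h3 h4
  refine (h1.norm_apply_le i j).trans ?_
  have e1 := (Complex.le_def.1 (Matrix.le_iff.1 h2).trace_nonneg).1
  have e3 := (Complex.le_def.1 h4.trace_nonneg).1
  have e2 := (Complex.le_def.1 h3).1
  simp [Matrix.trace_sub, Matrix.trace_smul] at e1 e2 e3
  calc (F x).trace.re ≤ C * (G x).trace.re := e1
    _ ≤ |C| * R := mul_le_mul (le_abs_self C) e2 e3 (abs_nonneg C)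

variable [IsProbabilityMeasure μ]

theorem IsBoundedPosSemidef.integrable_sum_mul {F G : Ω → Matrix ι ι ℂ}
    (hF : IsBoundedPosSemidef μ F) (hG : IsBoundedPosSemidef μ G) :
    Integrable (fun x => ∑ i, ∑ j, F x i j * G x i j) μ :=
  integrable_finsetSum _ fun i _ => integrable_finsetSum _ fun j _ =>
    ((MemLp.mul (p := ∞) (q := ∞) (r := ∞) (hG.memLp i j) (hF.memLp i j)).mono_exponent
      (p := 1) le_top).integrable le_rfl

variable {P : Lp ℂ ∞ μ →ₗ[ℂ] Lp ℂ ∞ μ}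

/-- A negative constant forces `tr (P G) = 0`; since `P` preserves the integral, `∫ tr G = 0`, and a
positive semidefinite matrix of trace zero vanishes. This settles the case `C < 0`. -/
theorem IsMarkovPreserving.ae_eq_zero_of_smul_nonneg (hP : IsMarkovPreserving μ P)
    {G : Ω → Matrix ι ι ℂ} (hG : IsBoundedPosSemidef μ G) {C : ℝ} (hC : C < 0)
    (h : ∀ᵐ x ∂μ, 0 ≤ (C : ℂ) • mapEntries P G x) : ∀ᵐ x ∂μ, G x = 0 := by
  have hPG := hG.mapEntries hP.isPositiveUnital
  have hm : MemLp (fun x => (G x).trace) ∞ μ := memLp_finsetSum _ fun i _ => hG.memLp i i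
  have h0 : P (toLpClass ∞ μ fun x => (G x).trace) =ᵐ[μ] fun _ => 0 := by
    filter_upwards [mapEntries_trace_ae P hG.memLp, h, hPG.posSemidef] with x h1 h2 h3
    rw [h1]
    have e1 := (Matrix.nonneg_iff_posSemidef.1 h2).trace_nonneg
    have e2 := h3.trace_nonneg
    rw [Matrix.trace_smul] at e1
    refine le_antisymm ?_ e2
    have e3 := Complex.le_def.1 e1
    have e4 := Complex.le_def.1 e2
    simp at e3 e4
    refine Complex.le_def.2 ⟨?_, e4.2.symm⟩
    simp only [Complex.zero_re]
    nlinarith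
  have hint : ∫ x, (G x).trace ∂μ = 0 := by
    rw [← integral_congr_ae (toLpClass_coeFn hm), ← hP.integral_map, integral_congr_ae h0]
    simp
  have hi : Integrable (fun x => (G x).trace) μ :=
    (hm.mono_exponent (p := 1) le_top).integrable le_rfl
  have hre : ∫ x, (G x).trace.re ∂μ = 0 := by
    have := integral_re hi
    simp only [RCLike.re_eq_complex_re] at this
    rw [this, hint]; simp
  have hz := (integral_eq_zero_iff_of_nonneg_ae (by
    filter_upwards [hG.posSemidef] with x hx
    exact (Complex.le_def.1 hx.trace_nonneg).1) hi.re).1 hre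
  filter_upwards [hz, hG.posSemidef] with x h1 h2
  ext i j
  have := h2.norm_apply_le i j
  rw [show (G x).trace.re = 0 from h1] at this
  simpa using this

/-- If `[Γ'] ≤ C P[Γ]` then, with `Q = P†`,
`∫ Σ A^s ⊗ B^(1-s) Γ' ≤ C ∫ Σ (Q A)^s ⊗ (Q B)^(1-s) Γ`. -/
theorem IsMarkovPreserving.integral_powKron_le (hP : IsMarkovPreserving μ P) {n : ℕ}
    {A B : Ω → Matrix (Fin n) (Fin n) ℂ} (hA : IsBoundedPosSemidef μ A)
    (hB : IsBoundedPosSemidef μ B) {G G' : Ω → Matrix (Fin n × Fin n) (Fin n × Fin n) ℂ}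
    (hG : IsBoundedPosSemidef μ G) (hG' : IsBoundedPosSemidef μ G') {C : ℝ}
    (h : ∀ᵐ x ∂μ, G' x ≤ (C : ℂ) • mapEntries P G x) {s : ℝ} (hs : 0 ≤ s) (hs' : s ≤ 1)
    (hJ : ∀ᵐ x ∂μ, mapEntries (daggerTop μ P) (fun y => powKron (A y) (B y) s (1 - s)) x ≤
      powKron (mapEntries (daggerTop μ P) A x) (mapEntries (daggerTop μ P) B x) s (1 - s)) :
    ∫ x, ∑ p, ∑ q, powKron (A x) (B x) s (1 - s) p q * G' x p q ∂μ ≤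
      (C : ℂ) * ∫ x, ∑ p, ∑ q, powKron (mapEntries (daggerTop μ P) A x)
        (mapEntries (daggerTop μ P) B x) s (1 - s) p q * G x p q ∂μ := by
  have hQ := hP.daggerTop_isPositiveUnital
  have hM := hA.powKron hB hs hs' (sub_nonneg.2 hs') (sub_le_self 1 hs)
  have hN := (hA.mapEntries hQ).powKron (hB.mapEntries hQ) hs hs' (sub_nonneg.2 hs')
    (sub_le_self 1 hs)
  have hPG := hG.mapEntries hP.isPositiveUnital
  have hQM := hM.mapEntries hQ
  calc ∫ x, ∑ p, ∑ q, powKron (A x) (B x) s (1 - s) p q * G' x p q ∂μ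
      ≤ ∫ x, (C : ℂ) * ∑ p, ∑ q, powKron (A x) (B x) s (1 - s) p q * mapEntries P G x p q ∂μ := by
        refine integral_mono_ae (hM.integrable_sum_mul hG')
          ((hM.integrable_sum_mul hPG).const_mul _) ?_
        filter_upwards [h, hM.posSemidef] with x h1 h2
        have := Matrix.sum_mul_le_sum_mul h1 h2
        simp only [Matrix.smul_apply, smul_eq_mul] at this
        simp only [Finset.mul_sum]
        simpa only [mul_comm, mul_left_comm] using this
    _ = (C : ℂ) * ∫ x, ∑ p, ∑ q, mapEntries (daggerTop μ P)
          (fun y => powKron (A y) (B y) s (1 - s)) x p q * G x p q ∂μ := by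
        rw [integral_const_mul, hP.integral_sum_mul hM hG.memLp]
    _ ≤ _ := by
        -- Jensen may be multiplied by `C` only if `C ≥ 0`. For negative `C`, `0 ≤ G' ≤ C P G`
        -- forces `G = 0`, and both sides vanish.
        rcases le_or_gt 0 C with hC | hC
        · refine mul_le_mul_of_nonneg_left ?_ (by exact_mod_cast hC)
          refine integral_mono_ae (hQM.integrable_sum_mul hG) (hN.integrable_sum_mul hG) ?_
          filter_upwards [hJ, hG.posSemidef] with x h1 h2
          exact Matrix.sum_mul_le_sum_mul h1 h2
        · have hz : ∀ᵐ x ∂μ, G x = 0 := by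
            refine hP.ae_eq_zero_of_smul_nonneg hG hC ?_
            filter_upwards [h, hG'.posSemidef] with x h1 h2
            exact (Matrix.nonneg_iff_posSemidef.2 h2).trans h1
          have hz' : ∀ F : Ω → Matrix (Fin n × Fin n) (Fin n × Fin n) ℂ,
              ∫ x, ∑ p, ∑ q, F x p q * G x p q ∂μ = 0 := by
            intro F
            rw [integral_congr_ae (g := fun _ => 0)]
            · simp
            · filter_upwards [hz] with x hx
              simp [hx]
          rw [hz', hz']

/-- The kernel bound is independent of the exponent, which supplies the dominating function. The
exponent stays strictly inside `(0, 1)`, since `A^t` may jump at `t = 0` and `B^(1-t)` at `t = 1`.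
-/
theorem tendsto_integral_powKron {n : ℕ} {A B : Ω → Matrix (Fin n) (Fin n) ℂ}
    (hA : IsBoundedPosSemidef μ A) (hB : IsBoundedPosSemidef μ B)
    {G : Ω → Matrix (Fin n × Fin n) (Fin n × Fin n) ℂ} (hG : IsBoundedPosSemidef μ G)
    {s : ℝ} (hs : 0 < s) (hs' : s < 1) {t : ℕ → ℝ} (ht : ∀ m, 0 ≤ t m) (ht' : ∀ m, t m ≤ 1)
    (hts : Filter.Tendsto t Filter.atTop (nhds s)) :
    Filter.Tendsto
      (fun m => ∫ x, ∑ p, ∑ q, powKron (A x) (B x) (t m) (1 - t m) p q * G x p q ∂μ) Filter.atTop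
      (nhds (∫ x, ∑ p, ∑ q, powKron (A x) (B x) s (1 - s) p q * G x p q ∂μ)) := by
  obtain ⟨R, hR⟩ := hA.exists_trace_le
  obtain ⟨R', hR'⟩ := hB.exists_trace_le
  refine tendsto_integral_of_dominated_convergence
    (fun x => ∑ p, ∑ q, ((n + R) * (n + R')) * ‖G x p q‖) (fun m => ?_) ?_ (fun m => ?_) ?_
  · exact ((hA.powKron hB (ht m) (ht' m) (sub_nonneg.2 (ht' m))
      (sub_le_self 1 (ht m))).integrable_sum_mul hG).1
  · refine integrable_finsetSum _ fun p _ => integrable_finsetSum _ fun q _ => ?_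
    exact ((((hG.memLp p q).mono_exponent (p := 1) le_top).integrable le_rfl).norm).const_mul _
  · filter_upwards [hA.posSemidef, hB.posSemidef, hR, hR'] with x h1 h2 h3 h4
    refine (norm_sum_le _ _).trans (Finset.sum_le_sum fun p _ => (norm_sum_le _ _).trans
      (Finset.sum_le_sum fun q _ => ?_))
    rw [norm_mul]
    refine mul_le_mul_of_nonneg_right ?_ (norm_nonneg _)
    refine (norm_powKron_apply_le h1 h2 (ht m) (ht' m) (sub_nonneg.2 (ht' m))
      (sub_le_self 1 (ht m)) p q).trans ?_
    have e1 := (Complex.le_def.1 h3).1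
    have e2 := (Complex.le_def.1 h4).1
    have e3 := (Complex.le_def.1 h1.trace_nonneg).1
    have e4 := (Complex.le_def.1 h2.trace_nonneg).1
    simp only [Complex.ofReal_re, Complex.zero_re] at e1 e2 e3 e4
    have := Nat.cast_nonneg (α := ℝ) n
    gcongr
    linarith
  · filter_upwards [hA.posSemidef, hB.posSemidef] with x h1 h2
    exact tendsto_finsetSum _ fun p _ => tendsto_finsetSum _ fun q _ =>
      ((tendsto_powKron_apply h1 h2 hs hs' p q).comp hts).mul_const _

/-- The limit from dyadic to real exponents is taken in the integrals, where the map already acts on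
`A` and `B` only and no continuity of it is needed. The endpoints are themselves dyadic and are
treated directly. -/
theorem IsMarkovPreserving.integral_powKron_le_of_le (hP : IsMarkovPreserving μ P) {n : ℕ}
    {A B : Ω → Matrix (Fin n) (Fin n) ℂ} (hA : IsBoundedPosSemidef μ A)
    (hB : IsBoundedPosSemidef μ B) {G G' : Ω → Matrix (Fin n × Fin n) (Fin n × Fin n) ℂ}
    (hG : IsBoundedPosSemidef μ G) (hG' : IsBoundedPosSemidef μ G') {C : ℝ}
    (h : ∀ᵐ x ∂μ, G' x ≤ (C : ℂ) • mapEntries P G x) {s : ℝ} (hs : 0 ≤ s) (hs' : s ≤ 1) :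
    ∫ x, ∑ p, ∑ q, powKron (A x) (B x) s (1 - s) p q * G' x p q ∂μ ≤
      (C : ℂ) * ∫ x, ∑ p, ∑ q, powKron (mapEntries (daggerTop μ P) A x)
        (mapEntries (daggerTop μ P) B x) s (1 - s) p q * G x p q ∂μ := by
  have hQ := hP.daggerTop_isPositiveUnital
  rcases hs.eq_or_lt with rfl | hs0
  · refine hP.integral_powKron_le hA hB hG hG' h le_rfl zero_le_one ?_
    simpa using hQ.jensen_dyadic hA hB 0 0 (by simp)
  rcases hs'.eq_or_lt with rfl | hs1
  · refine hP.integral_powKron_le hA hB hG hG' h zero_le_one le_rfl ?_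
    simpa using hQ.jensen_dyadic hA hB 0 1 (by simp)
  have hfloor : ∀ m : ℕ, ⌊s * 2 ^ m⌋₊ ≤ 2 ^ m := fun m => by
    have h1 : s * 2 ^ m ≤ ((2 ^ m : ℕ) : ℝ) := by
      push_cast
      exact mul_le_of_le_one_left (by positivity) hs'
    exact Nat.floor_le_of_le h1
  -- Dyadic approximation of `s` from below, staying in `[0, 1]`.
  set t : ℕ → ℝ := fun m => (⌊s * 2 ^ m⌋₊ : ℝ) / 2 ^ m with ht
  have ht0 : ∀ m, 0 ≤ t m := fun m => by positivity
  have ht1 : ∀ m, t m ≤ 1 := fun m => by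
    rw [ht, div_le_one (by positivity)]
    exact_mod_cast hfloor m
  have hts : Filter.Tendsto t Filter.atTop (nhds s) :=
    (tendsto_nat_floor_mul_div_atTop hs).comp (tendsto_pow_atTop_atTop_of_one_lt one_lt_two)
  refine le_of_tendsto_of_tendsto' (tendsto_integral_powKron hA hB hG' hs0 hs1 ht0 ht1 hts)
    ((tendsto_integral_powKron (hA.mapEntries hQ) (hB.mapEntries hQ) hG hs0 hs1 ht0 ht1
      hts).const_mul (C : ℂ)) fun m => ?_
  exact hP.integral_powKron_le hA hB hG hG' h (ht0 m) (ht1 m)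
    (hQ.jensen_dyadic hA hB m _ (hfloor m))

end Pairing

/-! ## The main theorem -/

theorem IsMatrixTestFunction.isBoundedPosSemidef {d : ℕ} {M : Type*} [TopologicalSpace M]
    [ChartedSpace (EuclideanSpace ℝ (Fin d)) M] [MeasurableSpace M] [OpensMeasurableSpace M]
    {μ : Measure M} [IsProbabilityMeasure μ] {n : ℕ} {A : M → Matrix (Fin n) (Fin n) ℂ}
    (hA : IsMatrixTestFunction (d := d) A) (hA0 : ∀ x, 0 ≤ A x) : IsBoundedPosSemidef μ A :=
  ⟨fun i j => (hA i j).memLp μ ∞, .of_forall fun x => Matrix.nonneg_iff_posSemidef.1 (hA0 x)⟩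

theorem mainTheorem6 {d : ℕ} {M : Type*} [TopologicalSpace M] [T2Space M]
    [SecondCountableTopology M] [ChartedSpace (EuclideanSpace ℝ (Fin d)) M]
    [IsManifold 𝓘(ℝ, EuclideanSpace ℝ (Fin d)) ∞ M] [MeasurableSpace M] [BorelSpace M]
    (g : Bundle.ContMDiffRiemannianMetric 𝓘(ℝ, EuclideanSpace ℝ (Fin d)) ∞
      (EuclideanSpace ℝ (Fin d))
      (fun x : M => TangentSpace 𝓘(ℝ, EuclideanSpace ℝ (Fin d)) x))
    (μ : Measure M) [IsProbabilityMeasure μ] (hμ : HasSmoothDensity g μ)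
    {k : ℕ} (X : Fin k → ∀ x : M, TangentSpace 𝓘(ℝ, EuclideanSpace ℝ (Fin d)) x)
    (hX : ∀ m, IsSmoothVectorField (X m))
    (P : Lp ℂ ∞ μ →ₗ[ℂ] Lp ℂ ∞ μ) (hP : IsMarkovPreserving μ P)
    (hreg : ∀ f : M → ℂ, IsTestFunction (d := d) f →
      HasC1Version (d := d) μ (P (toLpClass ∞ μ f)))
    (C : ℝ)
    (hgrad : ∀ f : M → ℂ, IsTestFunction (d := d) f →
      ∀ᵐ x ∂μ, gradForm X (applyP (d := d) μ P f) (applyP (d := d) μ P f) x ≤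
        (C : ℂ) * P (toLpClass ∞ μ (gradForm X f f)) x) :
    (∀ (n : ℕ) (f : Fin n → M → ℂ), (∀ i, IsTestFunction (d := d) (f i)) →
      ∀ᵐ x ∂μ,
        (Matrix.of fun i j =>
          gradForm X (applyP (d := d) μ P (f i)) (applyP (d := d) μ P (f j)) x) ≤
        (C : ℂ) • matApplyLinf μ P (fun y => Matrix.of fun i j => gradForm X (f i) (f j) y) x) ∧
    (∀ (n : ℕ) (s : ℝ), 0 ≤ s → s ≤ 1 →
      ∀ f A B : M → Matrix (Fin n) (Fin n) ℂ,
        IsMatrixTestFunction (d := d) f → IsMatrixTestFunction (d := d) A →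
        IsMatrixTestFunction (d := d) B → (∀ x, 0 ≤ A x) → (∀ x, 0 ≤ B x) →
        Integrable (gradPairing X (matApplyP (d := d) μ P f)
          (fun x => matPow (A x) s) (fun x => matPow (B x) (1 - s))) μ ∧
        Integrable (gradPairing X f
          (fun x => matPow (matDagger μ P A x) s)
          (fun x => matPow (matDagger μ P B x) (1 - s))) μ ∧
        ∫ x, gradPairing X (matApplyP (d := d) μ P f)
            (fun x => matPow (A x) s) (fun x => matPow (B x) (1 - s)) x ∂μ ≤
          (C : ℂ) * ∫ x, gradPairing X f
            (fun x => matPow (matDagger μ P A x) s)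
            (fun x => matPow (matDagger μ P B x) (1 - s)) x ∂μ) ∧
    (∀ (n : ℕ) (f : M → Matrix (Fin n) (Fin n) ℂ), IsMatrixTestFunction (d := d) f →
      ∀ᵐ x ∂μ,
        matGradForm X (matApplyP (d := d) μ P f) (matApplyP (d := d) μ P f) x ≤
          (C : ℂ) • matApplyLinf μ P (matGradForm X f f) x) := by
  have hle := fun (ι : Type) (_ : Fintype ι) (f : ι → M → ℂ)
      (hf : ∀ i, IsTestFunction (d := d) (f i)) =>
    gradMatrix_applyP_le (ι := ι) hμ hX hreg hgrad hf
  refine ⟨fun n f hf => hle (Fin n) inferInstance f hf, ?_, ?_⟩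
  · intro n s hs hs' f A B hf hA hB hA0 hB0
    have hA' : IsBoundedPosSemidef μ A := hA.isBoundedPosSemidef hA0
    have hB' : IsBoundedPosSemidef μ B := hB.isBoundedPosSemidef hB0
    have hQ := hP.daggerTop_isPositiveUnital
    have hft : ∀ p : Fin n × Fin n, IsTestFunction (d := d) fun y => f y p.1 p.2 :=
      fun p => hf p.1 p.2
    have hG := gradMatrix_isBoundedPosSemidef (μ := μ) hX hft
    have hG'le := hle (Fin n × Fin n) inferInstance _ hft
    have hG' : IsBoundedPosSemidef μ
        (gradMatrix X fun (p : Fin n × Fin n) => applyP (d := d) μ P fun y => f y p.1 p.2) := by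
      refine (hG.mapEntries hP.isPositiveUnital).of_le (fun p q => ?_)
        (.of_forall fun x => gradMatrix_posSemidef X _ x) hG'le
      have hc : ∀ (p : Fin n × Fin n) m, Continuous
          (lieDeriv (X m) (applyP (d := d) μ P fun y => f y p.1 p.2)) := fun p m =>
        continuous_lieDeriv (hX m) (applyP_contMDiff (hreg _ (hft p)))
      have hcont : Continuous fun x => gradMatrix X
          (fun (p : Fin n × Fin n) => applyP (d := d) μ P fun y => f y p.1 p.2) x p q :=
        continuous_finsetSum Finset.univ fun m _ => ((hc p m).star).mul (hc q m)
      exact hcont.aestronglyMeasurable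
    have e1 : gradPairing X (matApplyP (d := d) μ P f) (fun x => matPow (A x) s)
        (fun x => matPow (B x) (1 - s)) = fun x => ∑ p, ∑ q, powKron (A x) (B x) s (1 - s) p q *
          gradMatrix X (fun (p : Fin n × Fin n) => applyP (d := d) μ P fun y => f y p.1 p.2)
            x p q := funext fun x => gradPairing_eq_sum X _ A B s (1 - s) x
    have e2 : gradPairing X f (fun x => matPow (matDagger μ P A x) s)
        (fun x => matPow (matDagger μ P B x) (1 - s)) = fun x => ∑ p, ∑ q,
          powKron (mapEntries (daggerTop μ P) A x) (mapEntries (daggerTop μ P) B x) s (1 - s) p q *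
          gradMatrix X (fun (p : Fin n × Fin n) y => f y p.1 p.2) x p q := by
      rw [funext (matDagger_eq_mapEntries hA'.memLp), funext (matDagger_eq_mapEntries hB'.memLp)]
      exact funext fun x => gradPairing_eq_sum X _ _ _ s (1 - s) x
    have hs1 : 0 ≤ 1 - s := sub_nonneg.2 hs'
    have hs2 : 1 - s ≤ 1 := sub_le_self 1 hs
    rw [e1, e2]
    exact ⟨(hA'.powKron hB' hs hs' hs1 hs2).integrable_sum_mul hG',
      ((hA'.mapEntries hQ).powKron (hB'.mapEntries hQ) hs hs' hs1 hs2).integrable_sum_mul hG,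
      hP.integral_powKron_le_of_le hA' hB' hG hG' hG'le hs hs'⟩
  · intro n f hf
    have hsum : ∀ i j, P (toLpClass ∞ μ fun y => matGradForm X f f y i j) =ᵐ[μ]
        fun x => ∑ l, mapEntries P (gradMatrix X fun i y => f y l i) x i j := by
      intro i j
      have h := P.toLpClass_sum_ae (Finset.univ : Finset (Fin n)) (fun _ => 1)
        (f := fun l => gradForm X (fun y => f y l i) (fun y => f y l j))
        fun l => (hf l i).gradForm_memLp hX (hf l j) μ
      simp only [one_mul] at h
      exact h
    -- The matrix-valued gradient form is the sum over rows `l` of the Gram matrices of the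
    -- functions `f l i`, so (i) is applied to each row and the inequalities are added.
    filter_upwards [ae_all_iff.2 fun l => hle (Fin n) inferInstance (fun i y => f y l i) (hf l),
      ae_all_iff.2 fun i => ae_all_iff.2 fun j => hsum i j] with x h1 h2
    have e1 : matGradForm X (matApplyP (d := d) μ P f) (matApplyP (d := d) μ P f) x =
        ∑ l, gradMatrix X (fun i => applyP (d := d) μ P fun y => f y l i) x := by
      ext i j
      rw [Matrix.sum_apply]
      rfl
    have e2 : matApplyLinf μ P (matGradForm X f f) x =
        ∑ l, mapEntries P (gradMatrix X fun i y => f y l i) x := by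
      ext i j
      rw [Matrix.sum_apply]
      exact h2 i j
    rw [e1, e2, Finset.smul_sum]
    exact Finset.sum_le_sum fun l _ => h1 l
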